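/- Let $d\ge 1$, let $\hat K=\Omega=(0,1)^d$ be the unit cube (called $\hat K$ as a reference element and $\Omega$ as a domain), let $\hat S$ be a finite dimensional subspace of $L^2(\hat K)$, and let $r\ge 0$ be an integer. Let $\mathcal P_k$ denote the space of polynomials in $d$ variables of total degree at most $k$. For $n=1,2,\dots$ and $h=1/n$, let $\mathcal T_h$ be the uniform mesh of $\Omega$ into $n^d$ congruent subcubes $K=x_K+h\hat K$ of side $h$, and let $S_h$ be the space of functions $v:\Omega\to\mathbb R$ such that, for every $K\in\mathcal T_h$, the function $\hat x\mapsto v(x_K+h\hat x)$ agrees almost everywhere on $\hat K$ with an element of $\hat S$ (no continuity between elements is imposed). Let $\nabla_h$ denote the weak gradient taken separately on each element $K\in\mathcal T_h$. The infima below are over those $v\in S_h$ for which $\nabla_h v$ exists in $L^2$, that is, $v|_K\in H^1(K)$ for all $K\in\mathcal T_h$. Let $|u|_{r+1}=\bigl(\sum_{|\alpha|=r+1}\|D^\alpha u\|_{L^2(\Omega)}^2\bigr)^{1/2}$. Then the following conditions are equivalent: 1. There is a constant $C$, independent of $u$ and of $h=1/n$, such that $$\inf_{v\in S_h}\|\nabla_h(u-v)\|_{L^2(\Omega)}\le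 C h^{r}|u|_{r+1}\qquad\text{for all }u\in H^{r+1}(\Omega)\text{ and all } h=1/n,\ n\geq 1.$$ 2. For every $u\in\mathcal P_r(\Omega)$, $\displaystyle\inf_{v\in S_h}\|\nabla_h(u-v)\|_{L^2(\Omega)}=o(h^{r-1})$ as $h=1/n\to 0$. 3. $\mathcal P_r(\hat K)\subset\mathcal P_0(\hat K)+\hat S$. -/

import Mathlib

open MeasureTheory Filter Asymptotics
open scoped ContDiff

noncomputable section

namespace CubeFE

variable {d : ℕ}

/-! ### Sobolev spaces on open subsets of `ℝ^d`, through weak derivatives -/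

/-- The classical partial derivative `∂φ/∂x_i`. -/
def pderiv (i : Fin d) (φ : (Fin d → ℝ) → ℝ) : (Fin d → ℝ) → ℝ :=
  fun x => fderiv ℝ φ x (Pi.single i 1)

/-- The classical derivative `D^α φ = ∂_1^{α_1} ⋯ ∂_d^{α_d} φ` for a multi-index `α`. -/
def mderiv (α : Fin d → ℕ) (φ : (Fin d → ℝ) → ℝ) : (Fin d → ℝ) → ℝ :=
  (List.finRange d).foldr (fun i f => (pderiv i)^[α i] f) φ

/-- `g` is the weak derivative `D^α u` of `u` on the open set `U`. -/
def HasWeakDeriv (U : Set (Fin d → ℝ)) (α : Fin d → ℕ) (u g : (Fin d → ℝ) → ℝ) : Prop :=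
  LocallyIntegrableOn u U ∧ LocallyIntegrableOn g U ∧
    ∀ φ : (Fin d → ℝ) → ℝ, ContDiff ℝ ∞ φ → HasCompactSupport φ → tsupport φ ⊆ U →
      ∫ x in U, u x * mderiv α φ x = (-1 : ℝ) ^ (∑ i, α i) * ∫ x in U, g x * φ x

open Classical in
/-- The weak derivative `D^α u` on `U` (well defined up to null sets; `0` if there is none). -/
def weakDeriv (U : Set (Fin d → ℝ)) (α : Fin d → ℕ) (u : (Fin d → ℝ) → ℝ) : (Fin d → ℝ) → ℝ :=
  if h : ∃ g, HasWeakDeriv U α u g then h.choose else 0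

/-- `u ∈ H^k(U)`: `u` and all its weak derivatives of order at most `k` are in `L²(U)`. -/
def MemH (k : ℕ) (U : Set (Fin d → ℝ)) (u : (Fin d → ℝ) → ℝ) : Prop :=
  MemLp u 2 (volume.restrict U) ∧
    ∀ α : Fin d → ℕ, ∑ i, α i ≤ k →
      ∃ g, HasWeakDeriv U α u g ∧ MemLp g 2 (volume.restrict U)

/-- The norm of `L²(U)`. -/
def l2norm (U : Set (Fin d → ℝ)) (f : (Fin d → ℝ) → ℝ) : ℝ :=
  (eLpNorm f 2 (volume.restrict U)).toReal

/-- The seminorm `|u|_k = (∑_{|α| = k} ‖D^α u‖²)^{1/2}` of `H^k(U)`. -/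
def seminormH (k : ℕ) (U : Set (Fin d → ℝ)) (u : (Fin d → ℝ) → ℝ) : ℝ :=
  √(∑ α ∈ Finset.piAntidiag (Finset.univ : Finset (Fin d)) k, l2norm U (weakDeriv U α u) ^ 2)

/-! ### Cubes, meshes and the piecewise spaces -/

/-- The cube `a + h (0,1)^d`. Its faces are null sets, so `L²` and almost everywhere equality
are the same on the open and on the closed cube; the open one is the domain of the Sobolev
spaces. -/
def cube (a : Fin d → ℝ) (h : ℝ) : Set (Fin d → ℝ) :=
  Set.univ.pi fun i => Set.Ioo (a i) (a i + h)

variable (d) in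
/-- The unit cube, both as the reference element and as the domain `Ω`. -/
def unitCube : Set (Fin d → ℝ) := cube 0 1

variable (d) in
/-- The space `L²` of the reference element. -/
abbrev L2Ref : Type := Lp ℝ 2 (volume.restrict (unitCube d))

/-- `S(K)` for the cube `K = a + h (0,1)^d`: the functions `u` on `K` whose pull-back
`x ↦ u (a + h x)` agrees almost everywhere on the reference element with a member of `S`. -/
def localSpace (S : Submodule ℝ (L2Ref d)) (a : Fin d → ℝ) (h : ℝ) :
    Set ((Fin d → ℝ) → ℝ) :=
  {u | ∃ s ∈ S, (fun x : Fin d → ℝ => u (a + h • x)) =ᵐ[volume.restrict (unitCube d)] s}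

/-- The lower corner `k / n` of an element of the uniform mesh of `Ω` into `n^d` cubes; the
element is `cube (corner n k) (1 / n)`, with `k` running over `{0, …, n - 1}^d`. -/
def corner (n : ℕ) (k : Fin d → Fin n) : Fin d → ℝ := fun i => ((k i : ℕ) : ℝ) / n

/-- The element with index `k` of the mesh of size `h = 1 / n`. -/
def element (n : ℕ) (k : Fin d → Fin n) : Set (Fin d → ℝ) := cube (corner n k) (1 / n)

/-- The space `S_h`, `h = 1 / n`, of functions whose restriction to every element `K` of the
mesh is in `S(K)`, without any continuity between elements. -/
def meshSpace (S : Submodule ℝ (L2Ref d)) (n : ℕ) : Set ((Fin d → ℝ) → ℝ) :=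
  {v | ∀ k : Fin d → Fin n, v ∈ localSpace S (corner n k) (1 / n)}

/-- `‖∇_h w‖_{L²(Ω)}`, the gradient being taken on each element separately. -/
def brokenGradNorm (n : ℕ) (w : (Fin d → ℝ) → ℝ) : ℝ :=
  √(∑ k : Fin d → Fin n, ∑ i : Fin d,
    l2norm (element n k) (weakDeriv (element n k) (Pi.single i 1) w) ^ 2)

/-- `inf_{v ∈ S_h} ‖∇_h (u - v)‖_{L²(Ω)}`, `h = 1 / n`. The members of `S_h` are a priori only
in `L²`; the infimum is over those for which `∇_h v` exists in `L²`, that is, which are in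
`H¹(K)` for each element `K`. -/
def gradBestApprox (S : Submodule ℝ (L2Ref d)) (n : ℕ) (u : (Fin d → ℝ) → ℝ) : ℝ :=
  sInf {e : ℝ | ∃ v ∈ meshSpace S n, (∀ k : Fin d → Fin n, MemH 1 (element n k) v) ∧
    e = brokenGradNorm n (u - v)}

/-! ### Polynomials -/

variable (d) in
/-- The space `P_r` of polynomials of total degree at most `r`, as a subspace of `L²` of the
reference element. -/
def polySpace (r : ℕ) : Submodule ℝ (L2Ref d) where
  carrier := {f | ∃ p : MvPolynomial (Fin d) ℝ, p.totalDegree ≤ r ∧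
    f =ᵐ[volume.restrict (unitCube d)] fun x => MvPolynomial.eval x p}
  zero_mem' := by
    refine ⟨0, by simp, ?_⟩
    filter_upwards [Lp.coeFn_zero ℝ 2 (volume.restrict (unitCube d))] with x h₁
    rw [h₁]
    simp
  add_mem' := by
    rintro f g ⟨p, hp, hfp⟩ ⟨q, hq, hgq⟩
    refine ⟨p + q, (MvPolynomial.totalDegree_add p q).trans (max_le hp hq), ?_⟩
    filter_upwards [Lp.coeFn_add f g, hfp, hgq] with x h₁ h₂ h₃
    rw [h₁, Pi.add_apply, h₂, h₃, map_add]
  smul_mem' := by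
    rintro c f ⟨p, hp, hfp⟩
    refine ⟨c • p, (MvPolynomial.totalDegree_smul_le c p).trans hp, ?_⟩
    filter_upwards [Lp.coeFn_smul c f, hfp] with x h₁ h₂
    rw [h₁, Pi.smul_apply, h₂, MvPolynomial.smul_eval, smul_eq_mul]

end CubeFE

end

/-!
Write `Q` for the unit cube and `h = 1 / n`.

Everything rests on the Poincaré inequality on `Q` for functions with weak gradient in `L²`
(`exists_poincare`), which is proved by duality. Let `ρ` be a bump of integral one in one variable.
Replacing a test function `φ` by `ρ (x_j) ∫ φ dx_j` changes it by `∂_j Φ` with a test function `Φ`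
whose norm is at most a constant times that of `φ` (`exists_average_coordinate`); tested against
`f`, the change is hence bounded by the norm of `∂_j f`. Doing so in each coordinate turns `φ` into
`(∫ φ) ∏ ρ (x_i)`, so that `f - c`, with `c` the mean of `f` of weight `∏ ρ (x_i)`, pairs with `φ`
to at most `C ‖∇ f‖ ‖φ‖`. Test functions being dense in `L²`, this bounds `‖f - c‖`.

Removing the means of the derivatives of highest order by a homogeneous polynomial, one degree
after the other, yields the Bramble–Hilbert lemma (`exists_brambleHilbert`). If
`P_r ⊆ P_0 + S`, then scaling it to the elements gives the estimate of order `h ^ r`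
(`exists_gradBestApprox_le`): on an element the approximating polynomial is, up to a constant, which
the gradient does not see, in the local space. The estimate is applied to polynomials of degree at
most `r`, whose derivatives of order `r + 1` vanish, to get the second condition.

For the implication from the second condition to the third, suppose that `P_k ⊆ P_0 + S` and let `p`
have degree at most `k + 1`. Then `p (a + h x) - h ^ (k + 1) p (x)` is in `P_k`, so by the Poincaré
inequality the error on each element is, after scaling to `Q`, at least a constant times
`h ^ (k + 1)` times the distance of `p` from `P_0 + S`. Summing over the `n ^ d` elements bounds the
error from below by `h ^ k` times that distance (`exists_le_brokenGradNorm`), which an error of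
order `o (h ^ k)` forces to be zero; since `P_0 + S` is finite dimensional and hence closed, `p`
belongs to it (`polySpace_le_of_isLittleO`).
-/

namespace CubeFE

variable {d : ℕ}

/-! ### Classical derivatives of smooth functions -/

lemma contDiff_pderiv {φ : (Fin d → ℝ) → ℝ} (h : ContDiff ℝ ∞ φ) (i : Fin d) :
    ContDiff ℝ ∞ (pderiv i φ) :=
  (h.fderiv_right (m := ∞) (by simp)).clm_apply contDiff_const

lemma pderiv_comm {φ : (Fin d → ℝ) → ℝ} (h : ContDiff ℝ ∞ φ) (i j : Fin d) :
    pderiv i (pderiv j φ) = pderiv j (pderiv i φ) := by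
  have hd : Differentiable ℝ (fderiv ℝ φ) :=
    (h.fderiv_right (m := ∞) (by simp)).differentiable (by simp)
  have key : ∀ (a b : Fin d) x, pderiv a (pderiv b φ) x =
      fderiv ℝ (fderiv ℝ φ) x (Pi.single a 1) (Pi.single b 1) := by
    intro a b x
    unfold pderiv
    rw [fderiv_clm_apply (hd x) (differentiableAt_const _)]
    simp
  funext x
  rw [key, key]
  exact (h.contDiffAt.isSymmSndFDerivAt (by
    rw [minSmoothness_of_isRCLikeNormedField]
    exact WithTop.coe_le_coe.2 (le_top (a := (2 : ℕ∞))))) _ _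

lemma pderiv_add {φ ψ : (Fin d → ℝ) → ℝ} (hφ : ContDiff ℝ ∞ φ) (hψ : ContDiff ℝ ∞ ψ)
    (i : Fin d) : pderiv i (φ + ψ) = pderiv i φ + pderiv i ψ := by
  funext x
  simp only [pderiv, Pi.add_apply]
  rw [fderiv_add (hφ.differentiable (by simp) x) (hψ.differentiable (by simp) x)]
  rfl

lemma pderiv_zero (i : Fin d) : pderiv i (0 : (Fin d → ℝ) → ℝ) = 0 := by
  funext x
  simp [pderiv]

lemma contDiff_iterate_pderiv {φ : (Fin d → ℝ) → ℝ} (h : ContDiff ℝ ∞ φ) (i : Fin d) (n : ℕ) :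
    ContDiff ℝ ∞ ((pderiv i)^[n] φ) := by
  induction n with
  | zero => exact h
  | succ n ih =>
    rw [Function.iterate_succ_apply']
    exact contDiff_pderiv ih i

lemma iterate_pderiv_comm {φ : (Fin d → ℝ) → ℝ} (h : ContDiff ℝ ∞ φ) (i j : Fin d) (n : ℕ) :
    (pderiv i)^[n] (pderiv j φ) = pderiv j ((pderiv i)^[n] φ) := by
  induction n with
  | zero => rfl
  | succ n ih =>
    rw [Function.iterate_succ_apply', Function.iterate_succ_apply', ih,
      pderiv_comm (contDiff_iterate_pderiv h i n)]

lemma contDiff_foldr_pderiv {φ : (Fin d → ℝ) → ℝ} (h : ContDiff ℝ ∞ φ) (α : Fin d → ℕ)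
    (l : List (Fin d)) : ContDiff ℝ ∞ (l.foldr (fun i f => (pderiv i)^[α i] f) φ) := by
  induction l with
  | nil => exact h
  | cons i l ih => exact contDiff_iterate_pderiv ih i _

lemma contDiff_mderiv {φ : (Fin d → ℝ) → ℝ} (h : ContDiff ℝ ∞ φ) (α : Fin d → ℕ) :
    ContDiff ℝ ∞ (mderiv α φ) :=
  contDiff_foldr_pderiv h α _

lemma foldr_pderiv_comm {φ : (Fin d → ℝ) → ℝ} (h : ContDiff ℝ ∞ φ) (α : Fin d → ℕ) (j : Fin d)
    (l : List (Fin d)) :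
    l.foldr (fun i f => (pderiv i)^[α i] f) (pderiv j φ) =
      pderiv j (l.foldr (fun i f => (pderiv i)^[α i] f) φ) := by
  induction l with
  | nil => rfl
  | cons i l ih =>
    rw [List.foldr_cons, List.foldr_cons, ih,
      iterate_pderiv_comm (contDiff_foldr_pderiv h α l)]

lemma mderiv_pderiv {φ : (Fin d → ℝ) → ℝ} (h : ContDiff ℝ ∞ φ) (α : Fin d → ℕ) (j : Fin d) :
    mderiv α (pderiv j φ) = pderiv j (mderiv α φ) :=
  foldr_pderiv_comm h α j _

lemma foldr_pderiv_add_single {φ : (Fin d → ℝ) → ℝ} (h : ContDiff ℝ ∞ φ) (α : Fin d → ℕ)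
    (j : Fin d) (l : List (Fin d)) (hl : l.Nodup) :
    l.foldr (fun i f => (pderiv i)^[(α + Pi.single j 1 : Fin d → ℕ) i] f) φ =
      if j ∈ l then pderiv j (l.foldr (fun i f => (pderiv i)^[α i] f) φ)
      else l.foldr (fun i f => (pderiv i)^[α i] f) φ := by
  induction l with
  | nil => simp
  | cons i l ih =>
    obtain ⟨hi, hl'⟩ := List.nodup_cons.1 hl
    rw [List.foldr_cons, ih hl']
    by_cases hij : i = j
    · subst hij
      simp only [hi, if_false, Pi.add_apply, Pi.single_eq_same, List.mem_cons, true_or, if_true,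
        List.foldr_cons, Function.iterate_succ_apply']
    · have : (α + Pi.single j 1 : Fin d → ℕ) i = α i := by simp [hij]
      rw [this]
      by_cases hj : j ∈ l
      · simp only [hj, if_true, List.mem_cons, or_true, List.foldr_cons]
        exact iterate_pderiv_comm (contDiff_foldr_pderiv h α l) _ _ _
      · simp [hj, Ne.symm hij]

lemma mderiv_add_single {φ : (Fin d → ℝ) → ℝ} (h : ContDiff ℝ ∞ φ) (α : Fin d → ℕ)
    (j : Fin d) : mderiv (α + Pi.single j 1) φ = pderiv j (mderiv α φ) := by
  have := foldr_pderiv_add_single h α j (List.finRange d) (List.nodup_finRange d)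
  rwa [if_pos (List.mem_finRange j)] at this

@[simp] lemma mderiv_zero (φ : (Fin d → ℝ) → ℝ) : mderiv 0 φ = φ := by
  unfold mderiv
  induction List.finRange d with
  | nil => rfl
  | cons i l ih => exact ih

lemma mderiv_single {φ : (Fin d → ℝ) → ℝ} (h : ContDiff ℝ ∞ φ) (j : Fin d) :
    mderiv (Pi.single j 1) φ = pderiv j φ := by
  rw [← zero_add (Pi.single j 1 : Fin d → ℕ), mderiv_add_single h, mderiv_zero]

lemma sum_add_single (α : Fin d → ℕ) (j : Fin d) :
    ∑ i, (α + Pi.single j 1 : Fin d → ℕ) i = ∑ i, α i + 1 := by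
  simp [Finset.sum_add_distrib]

/-- Every multi-index is reached from `0` by raising one entry at a time. -/
lemma multiIndex_induction {P : (Fin d → ℕ) → Prop} (h0 : P 0)
    (hs : ∀ α j, P α → P (α + Pi.single j 1)) (α : Fin d → ℕ) : P α := by
  induction hn : ∑ i, α i generalizing α with
  | zero =>
    have : α = 0 := by
      funext i
      exact (Finset.sum_eq_zero_iff.1 hn) i (Finset.mem_univ i)
    rwa [this]
  | succ n ih =>
    obtain ⟨j, -, hj⟩ : ∃ j ∈ Finset.univ, α j ≠ 0 := by
      by_contra! hcon
      rw [Finset.sum_eq_zero hcon] at hn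
      omega
    have hα : α = (α - Pi.single j 1) + Pi.single j 1 := by
      funext i
      by_cases hij : i = j
      · subst hij; simp; omega
      · simp [hij]
    rw [hα]
    apply hs
    apply ih
    have := sum_add_single (α - Pi.single j 1) j
    rw [← hα] at this
    omega

lemma mderiv_add {φ ψ : (Fin d → ℝ) → ℝ} (hφ : ContDiff ℝ ∞ φ) (hψ : ContDiff ℝ ∞ ψ)
    (α : Fin d → ℕ) : mderiv α (φ + ψ) = mderiv α φ + mderiv α ψ := by
  induction α using multiIndex_induction with
  | h0 => simp
  | hs α j ih =>
    rw [mderiv_add_single (φ := φ + ψ) (hφ.add hψ), mderiv_add_single hφ, mderiv_add_single hψ, ih,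
      pderiv_add (contDiff_mderiv hφ α) (contDiff_mderiv hψ α)]

lemma mderiv_zero_fun (α : Fin d → ℕ) : mderiv α (0 : (Fin d → ℝ) → ℝ) = 0 := by
  induction α using multiIndex_induction with
  | h0 => simp
  | hs α j ih => rw [mderiv_add_single (φ := 0) contDiff_const, ih, pderiv_zero]

lemma mderiv_sum {ι : Type*} (s : Finset ι) {φ : ι → (Fin d → ℝ) → ℝ}
    (hφ : ∀ i, ContDiff ℝ ∞ (φ i)) (α : Fin d → ℕ) :
    mderiv α (∑ i ∈ s, φ i) = ∑ i ∈ s, mderiv α (φ i) := by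
  classical
  induction s using Finset.induction_on with
  | empty => simp [mderiv_zero_fun]
  | insert a s ha ih =>
    have hs : ContDiff ℝ ∞ (∑ i ∈ s, φ i) := by
      have : (∑ i ∈ s, φ i) = fun x => ∑ i ∈ s, φ i x := by funext x; simp
      rw [this]
      exact ContDiff.sum fun i _ => hφ i
    rw [Finset.sum_insert ha, Finset.sum_insert ha, mderiv_add (hφ a) hs, ih]

/-! ### Test functions -/

/-- `φ` is a test function on `U`: smooth with compact support inside `U`. -/
structure IsTest (U : Set (Fin d → ℝ)) (φ : (Fin d → ℝ) → ℝ) : Prop where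
  smooth : ContDiff ℝ ∞ φ
  compact : HasCompactSupport φ
  supp : tsupport φ ⊆ U

namespace IsTest

variable {U : Set (Fin d → ℝ)} {φ ψ : (Fin d → ℝ) → ℝ}

lemma eq_zero (h : IsTest U φ) {x : Fin d → ℝ} (hx : x ∉ U) : φ x = 0 :=
  image_eq_zero_of_notMem_tsupport fun hx' => hx (h.supp hx')

lemma pderiv (h : IsTest U φ) (i : Fin d) : IsTest U (pderiv i φ) := by
  have hs : tsupport (CubeFE.pderiv i φ) ⊆ tsupport φ := by
    refine (closure_mono ?_).trans (tsupport_fderiv_subset ℝ)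
    intro x hx hx'
    apply hx
    simp [CubeFE.pderiv, hx']
  exact ⟨contDiff_pderiv h.smooth i, h.compact.of_isClosed_subset (isClosed_tsupport _) hs,
    hs.trans h.supp⟩

lemma mderiv (h : IsTest U φ) (α : Fin d → ℕ) : IsTest U (mderiv α φ) := by
  induction α using multiIndex_induction with
  | h0 => simpa using h
  | hs α j ih =>
    rw [mderiv_add_single h.smooth]
    exact ih.pderiv j

lemma add (h : IsTest U φ) (h' : IsTest U ψ) : IsTest U (φ + ψ) :=
  ⟨h.smooth.add h'.smooth, h.compact.add h'.compact,
    (tsupport_add φ ψ).trans (Set.union_subset h.supp h'.supp)⟩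

lemma smooth_mul (h : IsTest U φ) (h' : ContDiff ℝ ∞ ψ) : IsTest U (fun x => ψ x * φ x) :=
  ⟨h'.mul h.smooth, h.compact.mul_left, (tsupport_mul_subset_right).trans h.supp⟩

lemma const_mul (h : IsTest U φ) (c : ℝ) : IsTest U (fun x => c * φ x) :=
  h.smooth_mul contDiff_const

lemma sub (h : IsTest U φ) (h' : IsTest U ψ) : IsTest U (φ - ψ) := by
  have := h.add (h'.const_mul (-1))
  convert this using 1
  funext x
  simp [sub_eq_add_neg]

lemma continuous (h : IsTest U φ) : Continuous φ := h.smooth.continuous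

lemma integrable_mul (h : IsTest U φ) {u : (Fin d → ℝ) → ℝ} (hu : LocallyIntegrableOn u U) :
    IntegrableOn (fun x => u x * φ x) U := by
  have h1 : IntegrableOn u (tsupport φ) := hu.integrableOn_compact_subset h.supp h.compact
  have h2 : IntegrableOn (fun x => u x * φ x) (tsupport φ) :=
    h1.mul_continuousOn h.continuous.continuousOn h.compact
  refine (h2.integrable_of_forall_notMem_eq_zero fun x hx => ?_).integrableOn
  rw [image_eq_zero_of_notMem_tsupport hx, mul_zero]

lemma memLp (h : IsTest U φ) (μ : Measure (Fin d → ℝ)) [IsFiniteMeasureOnCompacts μ]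
    (p : ENNReal) : MemLp φ p μ :=
  h.continuous.memLp_of_hasCompactSupport h.compact

end IsTest

/-! ### Weak derivatives -/

namespace HasWeakDeriv

variable {U V : Set (Fin d → ℝ)} {α : Fin d → ℕ} {u u' g g' : (Fin d → ℝ) → ℝ}

lemma mono (h : HasWeakDeriv U α u g) (hVU : V ⊆ U) :
    HasWeakDeriv V α u g := by
  refine ⟨h.1.mono_set hVU, h.2.1.mono_set hVU, fun φ h1 h2 h3 => ?_⟩
  have hT : IsTest V φ := ⟨h1, h2, h3⟩
  have key : ∀ (w ψ : (Fin d → ℝ) → ℝ), IsTest V ψ →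
      ∫ x in U, w x * ψ x = ∫ x in V, w x * ψ x := by
    intro w ψ hψ
    rw [setIntegral_eq_integral_of_forall_compl_eq_zero fun x hx => by
        rw [hψ.eq_zero fun h => hx (hVU h), mul_zero],
      setIntegral_eq_integral_of_forall_compl_eq_zero fun x hx => by rw [hψ.eq_zero hx, mul_zero]]
  rw [← key _ _ (hT.mderiv α), ← key _ _ hT]
  exact h.2.2 φ h1 h2 (h3.trans hVU)

lemma congr (h : HasWeakDeriv U α u g) (hu : u =ᵐ[volume.restrict U] u')
    (hg : g =ᵐ[volume.restrict U] g') : HasWeakDeriv U α u' g' := by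
  refine ⟨h.1.congr hu, h.2.1.congr hg, fun φ h1 h2 h3 => ?_⟩
  have e1 : ∫ x in U, u' x * mderiv α φ x = ∫ x in U, u x * mderiv α φ x :=
    integral_congr_ae (by filter_upwards [hu] with x hx; rw [hx])
  have e2 : ∫ x in U, g' x * φ x = ∫ x in U, g x * φ x :=
    integral_congr_ae (by filter_upwards [hg] with x hx; rw [hx])
  rw [e1, e2]
  exact h.2.2 φ h1 h2 h3

lemma add (h : HasWeakDeriv U α u g) (h' : HasWeakDeriv U α u' g') :
    HasWeakDeriv U α (u + u') (g + g') := by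
  refine ⟨h.1.add h'.1, h.2.1.add h'.2.1, fun φ h1 h2 h3 => ?_⟩
  have hT : IsTest U φ := ⟨h1, h2, h3⟩
  simp only [Pi.add_apply, add_mul]
  rw [integral_add ((hT.mderiv α).integrable_mul h.1) ((hT.mderiv α).integrable_mul h'.1),
    integral_add (hT.integrable_mul h.2.1) (hT.integrable_mul h'.2.1), h.2.2 φ h1 h2 h3,
    h'.2.2 φ h1 h2 h3, mul_add]

lemma const_smul (h : HasWeakDeriv U α u g) (c : ℝ) : HasWeakDeriv U α (c • u) (c • g) := by
  refine ⟨h.1.smul c, h.2.1.smul c, fun φ h1 h2 h3 => ?_⟩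
  simp only [Pi.smul_apply, smul_eq_mul, mul_assoc, integral_const_mul]
  rw [h.2.2 φ h1 h2 h3]
  ring

lemma sub (h : HasWeakDeriv U α u g) (h' : HasWeakDeriv U α u' g') :
    HasWeakDeriv U α (u - u') (g - g') := by
  simpa [sub_eq_add_neg] using h.add (h'.const_smul (-1))

lemma unique (hU : IsOpen U) (h : HasWeakDeriv U α u g) (h' : HasWeakDeriv U α u g') :
    g =ᵐ[volume.restrict U] g' := by
  have h0 := hU.ae_eq_zero_of_integral_contDiff_smul_eq_zero (h.2.1.sub h'.2.1) (μ := volume) ?_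
  · rw [Filter.EventuallyEq, ae_restrict_iff' hU.measurableSet]
    filter_upwards [h0] with x hx hxU
    exact sub_eq_zero.1 (hx hxU)
  · intro φ h1 h2 h3
    have hT : IsTest U φ := ⟨h1, h2, h3⟩
    rw [← setIntegral_eq_integral_of_forall_compl_eq_zero (s := U)
      (fun x hx => by rw [hT.eq_zero hx, zero_smul])]
    have e : ∫ x in U, g x * φ x = ∫ x in U, g' x * φ x := by
      have := (h.2.2 φ h1 h2 h3).symm.trans (h'.2.2 φ h1 h2 h3)
      exact mul_left_cancel₀ (pow_ne_zero _ (by norm_num)) this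
    have e2 := integral_sub (hT.integrable_mul h.2.1) (hT.integrable_mul h'.2.1)
    rw [e, sub_self] at e2
    rw [← e2]
    refine integral_congr_ae (ae_of_all _ fun x => ?_)
    simp only [smul_eq_mul, Pi.sub_apply]
    ring

lemma weakDeriv_ae_eq (hU : IsOpen U) (h : HasWeakDeriv U α u g) :
    weakDeriv U α u =ᵐ[volume.restrict U] g := by
  have hex : ∃ g, HasWeakDeriv U α u g := ⟨g, h⟩
  rw [weakDeriv, dif_pos hex]
  exact unique hU hex.choose_spec h

/-- A weak derivative of order `|α| + 1` is a first weak derivative of the one of order `|α|`. -/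
lemma of_add_single {i : Fin d} (h : HasWeakDeriv U α u g)
    (h' : HasWeakDeriv U (α + Pi.single i 1) u g') : HasWeakDeriv U (Pi.single i 1) g g' := by
  refine ⟨h.2.1, h'.2.1, fun φ h1 h2 h3 => ?_⟩
  have hT : IsTest U φ := ⟨h1, h2, h3⟩
  have e1 := h.2.2 _ (hT.pderiv i).smooth (hT.pderiv i).compact (hT.pderiv i).supp
  have e2 := h'.2.2 φ h1 h2 h3
  rw [mderiv_add_single h1, ← mderiv_pderiv h1, e1, sum_add_single, pow_succ, mul_assoc] at e2
  rw [mderiv_single h1, Finset.sum_pi_single', if_pos (Finset.mem_univ i), pow_one]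
  exact mul_left_cancel₀ (pow_ne_zero _ (by norm_num)) e2

lemma add_single {i : Fin d} (h : HasWeakDeriv U α u g)
    (h' : HasWeakDeriv U (Pi.single i 1) g g') : HasWeakDeriv U (α + Pi.single i 1) u g' := by
  refine ⟨h.1, h'.2.1, fun φ h1 h2 h3 => ?_⟩
  have hT : IsTest U φ := ⟨h1, h2, h3⟩
  have e1 := h.2.2 _ (hT.pderiv i).smooth (hT.pderiv i).compact (hT.pderiv i).supp
  have e2 := h'.2.2 φ h1 h2 h3
  rw [mderiv_single h1, Finset.sum_pi_single', if_pos (Finset.mem_univ i), pow_one] at e2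
  rw [mderiv_add_single h1, ← mderiv_pderiv h1, e1, e2, sum_add_single, pow_succ, mul_assoc]

lemma zero (h : LocallyIntegrableOn u U) : HasWeakDeriv U 0 u u :=
  ⟨h, h, fun φ _ _ _ => by simp⟩

end HasWeakDeriv

lemma hasWeakDeriv_pderiv {U : Set (Fin d → ℝ)} {p : (Fin d → ℝ) → ℝ}
    (hp : ContDiff ℝ ∞ p) (i : Fin d) : HasWeakDeriv U (Pi.single i 1) p (pderiv i p) := by
  refine ⟨hp.continuous.locallyIntegrable.locallyIntegrableOn _,
    (contDiff_pderiv hp i).continuous.locallyIntegrable.locallyIntegrableOn _,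
    fun φ h1 h2 h3 => ?_⟩
  have hT : IsTest U φ := ⟨h1, h2, h3⟩
  rw [mderiv_single h1, Finset.sum_pi_single', if_pos (Finset.mem_univ i), pow_one,
    setIntegral_eq_integral_of_forall_compl_eq_zero
      (fun x hx => by rw [(hT.pderiv i).eq_zero hx, mul_zero]),
    setIntegral_eq_integral_of_forall_compl_eq_zero
      (fun x hx => by rw [hT.eq_zero hx, mul_zero]), neg_one_mul]
  have hT' : IsTest Set.univ φ := ⟨h1, h2, Set.subset_univ _⟩
  have int : ∀ {w ψ : (Fin d → ℝ) → ℝ}, ContDiff ℝ ∞ w → IsTest Set.univ ψ →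
      Integrable (fun x => w x * ψ x) := fun hw hψ => by
    simpa using hψ.integrable_mul (hw.continuous.locallyIntegrable.locallyIntegrableOn _)
  exact integral_mul_fderiv_eq_neg_fderiv_mul_of_integrable
    (int (contDiff_pderiv hp i) hT') (int hp (hT'.pderiv i)) (int hp hT')
    (fun x _ => hp.differentiable (by simp) x) (fun x _ => h1.differentiable (by simp) x)

/-- The weak derivatives of a smooth function are the classical ones. -/
lemma hasWeakDeriv_mderiv {U : Set (Fin d → ℝ)} {p : (Fin d → ℝ) → ℝ}
    (hp : ContDiff ℝ ∞ p) (α : Fin d → ℕ) : HasWeakDeriv U α p (mderiv α p) := by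
  induction α using multiIndex_induction with
  | h0 =>
    rw [mderiv_zero]
    exact HasWeakDeriv.zero (hp.continuous.locallyIntegrable.locallyIntegrableOn _)
  | hs α i ih =>
    rw [mderiv_add_single hp]
    exact ih.add_single (hasWeakDeriv_pderiv (contDiff_mderiv hp α) i)

/-! ### Scaling between a cube and the unit cube -/

lemma pderiv_comp_affine {φ : (Fin d → ℝ) → ℝ} (hφ : ContDiff ℝ ∞ φ) (b : Fin d → ℝ) (c : ℝ)
    (i : Fin d) :
    pderiv i (fun x => φ (b + c • x)) = fun x => c * pderiv i φ (b + c • x) := by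
  funext x
  have h1 : HasFDerivAt (fun x : Fin d → ℝ => b + c • x) (c • ContinuousLinearMap.id ℝ _) x :=
    ((hasFDerivAt_id x).const_smul c).const_add b
  have h2 : HasFDerivAt φ (fderiv ℝ φ (b + c • x)) (b + c • x) :=
    (hφ.differentiable (by simp) _).hasFDerivAt
  have h3 := h2.comp x h1
  unfold pderiv
  rw [show (fun x => φ (b + c • x)) = φ ∘ fun x => b + c • x from rfl, h3.fderiv]
  simp

lemma contDiff_comp_affine {φ : (Fin d → ℝ) → ℝ} (hφ : ContDiff ℝ ∞ φ) (b : Fin d → ℝ) (c : ℝ) :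
    ContDiff ℝ ∞ (fun x => φ (b + c • x)) :=
  hφ.comp (contDiff_const.add (contDiff_id.const_smul c))

lemma mderiv_comp_affine {φ : (Fin d → ℝ) → ℝ} (hφ : ContDiff ℝ ∞ φ) (b : Fin d → ℝ) (c : ℝ)
    (α : Fin d → ℕ) :
    mderiv α (fun x => φ (b + c • x)) = fun x => c ^ (∑ i, α i) * mderiv α φ (b + c • x) := by
  induction α using multiIndex_induction with
  | h0 => simp
  | hs α j ih =>
    have hm := contDiff_mderiv hφ α
    rw [mderiv_add_single (contDiff_comp_affine hφ b c), ih, mderiv_add_single hφ,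
      sum_add_single]
    funext x
    have : pderiv j (fun x => c ^ (∑ i, α i) * mderiv α φ (b + c • x)) x =
        c ^ (∑ i, α i) * pderiv j (fun x => mderiv α φ (b + c • x)) x := by
      simp only [pderiv]
      rw [fderiv_const_mul ((contDiff_comp_affine hm b c).differentiable (by simp) x)]
      rfl
    rw [this, pderiv_comp_affine hm]
    ring

lemma isOpen_cube (a : Fin d → ℝ) (h : ℝ) : IsOpen (cube a h) :=
  isOpen_set_pi Set.finite_univ fun _ _ => isOpen_Ioo

lemma isOpen_unitCube : IsOpen (unitCube d) := isOpen_cube _ _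

lemma mem_unitCube {x : Fin d → ℝ} : x ∈ unitCube d ↔ ∀ i, 0 < x i ∧ x i < 1 := by
  simp [unitCube, cube]

lemma preimage_cube (a : Fin d → ℝ) {h : ℝ} (hh : 0 < h) :
    (fun x : Fin d → ℝ => a + h • x) ⁻¹' cube a h = unitCube d := by
  ext x
  simp only [Set.mem_preimage, mem_unitCube, cube, Set.mem_univ_pi, Set.mem_Ioo, Pi.add_apply,
    Pi.smul_apply, smul_eq_mul, lt_add_iff_pos_right, add_lt_add_iff_left]
  refine forall_congr' fun i => ?_
  rw [mul_pos_iff_of_pos_left hh, mul_lt_iff_lt_one_right hh]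

/-- The affine map of the unit cube onto `cube a h`, as a homeomorphism of `ℝ^d`. -/
noncomputable def affineHomeo (a : Fin d → ℝ) (h : ℝ) (hh : h ≠ 0) : (Fin d → ℝ) ≃ₜ (Fin d → ℝ) :=
  (Homeomorph.smulOfNeZero h hh).trans (Homeomorph.addLeft a)

lemma affineHomeo_apply (a : Fin d → ℝ) {h : ℝ} (hh : h ≠ 0) :
    ⇑(affineHomeo a h hh) = fun x => a + h • x := rfl

lemma measurableEmbedding_affine (a : Fin d → ℝ) {h : ℝ} (hh : 0 < h) :
    MeasurableEmbedding (fun x : Fin d → ℝ => a + h • x) :=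
  (affineHomeo a h hh.ne').measurableEmbedding

/-- The affine change of variables, as an identity of measures. -/
lemma map_affine_restrict (a : Fin d → ℝ) {h : ℝ} (hh : 0 < h) (s : Set (Fin d → ℝ)) :
    Measure.map (fun x : Fin d → ℝ => a + h • x)
        (volume.restrict ((fun x : Fin d → ℝ => a + h • x) ⁻¹' s)) =
      ENNReal.ofReal (h ^ d)⁻¹ • volume.restrict s := by
  rw [← (measurableEmbedding_affine a hh).restrict_map, ← Measure.restrict_smul]
  congr 1
  have : (fun x : Fin d → ℝ => a + h • x) = (fun x => a + x) ∘ (fun x => h • x) := rfl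
  rw [this, ← Measure.map_map (measurable_const_add a) (measurable_const_smul h),
    Measure.map_addHaar_smul _ hh.ne', Measure.map_smul, map_add_left_eq_self]
  rw [Module.finrank_fin_fun, abs_of_pos (by positivity)]

lemma map_affine_unitCube (a : Fin d → ℝ) {h : ℝ} (hh : 0 < h) :
    Measure.map (fun x : Fin d → ℝ => a + h • x) (volume.restrict (unitCube d)) =
      ENNReal.ofReal (h ^ d)⁻¹ • volume.restrict (cube a h) := by
  rw [← preimage_cube a hh, map_affine_restrict a hh]

lemma integral_comp_affine (a : Fin d → ℝ) {h : ℝ} (hh : 0 < h) (F : (Fin d → ℝ) → ℝ) :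
    ∫ x in unitCube d, F (a + h • x) = (h ^ d)⁻¹ * ∫ y in cube a h, F y := by
  rw [← (measurableEmbedding_affine a hh).integral_map, map_affine_unitCube a hh,
    integral_smul_measure, ENNReal.toReal_ofReal (by positivity), smul_eq_mul]

lemma locallyIntegrableOn_comp_affine (a : Fin d → ℝ) {h : ℝ} (hh : 0 < h)
    {u : (Fin d → ℝ) → ℝ} (hu : LocallyIntegrableOn u (cube a h)) :
    LocallyIntegrableOn (fun x => u (a + h • x)) (unitCube d) := by
  rw [locallyIntegrableOn_iff isOpen_unitCube.isLocallyClosed]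
  intro k hk hkc
  have hinj : Function.Injective (fun x : Fin d → ℝ => a + h • x) :=
    (measurableEmbedding_affine a hh).injective
  have h1 : IntegrableOn u ((fun x : Fin d → ℝ => a + h • x) '' k) := by
    refine hu.integrableOn_compact_subset ?_ (hkc.image (affineHomeo a h hh.ne').continuous)
    rw [Set.image_subset_iff, preimage_cube a hh]
    exact hk
  have h2 := map_affine_restrict a hh ((fun x : Fin d → ℝ => a + h • x) '' k)
  rw [hinj.preimage_image] at h2
  have h3 : Integrable u (Measure.map (fun x : Fin d → ℝ => a + h • x) (volume.restrict k)) := by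
    rw [h2]
    exact h1.smul_measure ENNReal.ofReal_ne_top
  exact ((measurableEmbedding_affine a hh).integrable_map_iff).1 h3

lemma IsTest.comp_affine {a : Fin d → ℝ} {h : ℝ} (hh : 0 < h) {φ : (Fin d → ℝ) → ℝ}
    (hφ : IsTest (unitCube d) φ) : IsTest (cube a h) (fun y => φ (-(h⁻¹ • a) + h⁻¹ • y)) := by
  have he : (fun y => φ (-(h⁻¹ • a) + h⁻¹ • y)) = φ ∘ (affineHomeo a h hh.ne').symm := by
    funext y
    rw [Function.comp_apply, eq_comm]
    congr 1
    rw [Homeomorph.symm_apply_eq, affineHomeo_apply]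
    simp only
    rw [smul_add, smul_neg, smul_smul, smul_smul, mul_inv_cancel₀ hh.ne', one_smul, one_smul,
      add_neg_cancel_left]
  refine ⟨contDiff_comp_affine hφ.smooth _ _, ?_, ?_⟩
  · rw [he]; exact hφ.compact.comp_homeomorph _
  · rw [he, tsupport_comp_eq_preimage]
    intro y hy
    have := hφ.supp hy
    rw [← preimage_cube a hh, ← affineHomeo_apply a hh.ne'] at this
    simpa using this

/-- Pulling back to the unit cube multiplies a weak derivative of order `k` by `h ^ k`. -/
lemma HasWeakDeriv.comp_affine {a : Fin d → ℝ} {h : ℝ} (hh : 0 < h) {α : Fin d → ℕ}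
    {u g : (Fin d → ℝ) → ℝ} (hu : HasWeakDeriv (cube a h) α u g) :
    HasWeakDeriv (unitCube d) α (fun x => u (a + h • x))
      (fun x => h ^ (∑ i, α i) * g (a + h • x)) := by
  refine ⟨locallyIntegrableOn_comp_affine a hh hu.1,
    (locallyIntegrableOn_comp_affine a hh hu.2.1).smul (h ^ (∑ i, α i)), fun φ h1 h2 h3 => ?_⟩
  have hφ : IsTest (unitCube d) φ := ⟨h1, h2, h3⟩
  have hψ := hφ.comp_affine (a := a) hh
  have e := hu.2.2 _ hψ.smooth hψ.compact hψ.supp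
  have inv : ∀ x : Fin d → ℝ, -(h⁻¹ • a) + h⁻¹ • (a + h • x) = x := fun x => by
    rw [smul_add, smul_smul, inv_mul_cancel₀ hh.ne', one_smul, neg_add_cancel_left]
  have e1 := integral_comp_affine a hh (fun y => u y *
    mderiv α (fun y => φ (-(h⁻¹ • a) + h⁻¹ • y)) y)
  have e2 := integral_comp_affine a hh (fun y => g y * φ (-(h⁻¹ • a) + h⁻¹ • y))
  rw [e] at e1
  rw [mderiv_comp_affine h1] at e1
  simp only [inv] at e1 e2
  have e3 : ∫ x in unitCube d, u (a + h • x) * mderiv α φ x = h ^ (∑ i, α i) *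
      ∫ x in unitCube d, u (a + h • x) * ((h⁻¹) ^ (∑ i, α i) * mderiv α φ x) := by
    rw [← integral_const_mul]
    refine integral_congr_ae (ae_of_all _ fun x => ?_)
    have : h ^ (∑ i, α i) * (h⁻¹) ^ (∑ i, α i) = 1 := by
      rw [← mul_pow, mul_inv_cancel₀ hh.ne', one_pow]
    linear_combination (-(u (a + h • x) * mderiv α φ x)) * this
  have e4 : ∫ x in unitCube d, h ^ (∑ i, α i) * g (a + h • x) * φ x = h ^ (∑ i, α i) *
      ∫ x in unitCube d, g (a + h • x) * φ x := by
    rw [← integral_const_mul]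
    refine integral_congr_ae (ae_of_all _ fun x => ?_)
    ring
  rw [e3, e4, e1, e2]
  ring

/-! ### The norm of `L²` -/

lemma l2norm_nonneg (U : Set (Fin d → ℝ)) (f : (Fin d → ℝ) → ℝ) : 0 ≤ l2norm U f :=
  ENNReal.toReal_nonneg

lemma l2norm_congr {U : Set (Fin d → ℝ)} {f g : (Fin d → ℝ) → ℝ}
    (h : f =ᵐ[volume.restrict U] g) : l2norm U f = l2norm U g := by
  rw [l2norm, eLpNorm_congr_ae h, l2norm]

lemma l2norm_const_smul (U : Set (Fin d → ℝ)) (c : ℝ) (f : (Fin d → ℝ) → ℝ) :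
    l2norm U (c • f) = |c| * l2norm U f := by
  rw [l2norm, eLpNorm_const_smul, ENNReal.toReal_mul, l2norm]
  simp

lemma l2norm_add_le {U : Set (Fin d → ℝ)} {f g : (Fin d → ℝ) → ℝ}
    (hf : MemLp f 2 (volume.restrict U)) (hg : MemLp g 2 (volume.restrict U)) :
    l2norm U (f + g) ≤ l2norm U f + l2norm U g := by
  rw [l2norm, l2norm, l2norm, ← ENNReal.toReal_add hf.2.ne hg.2.ne]
  exact ENNReal.toReal_mono (ENNReal.add_ne_top.2 ⟨hf.2.ne, hg.2.ne⟩)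
    (eLpNorm_add_le hf.1 hg.1 (by norm_num))

lemma l2norm_sq {U : Set (Fin d → ℝ)} {f : (Fin d → ℝ) → ℝ}
    (hf : MemLp f 2 (volume.restrict U)) : l2norm U f ^ 2 = ∫ x in U, f x ^ 2 := by
  have h := hf.eLpNorm_eq_integral_rpow_norm (by norm_num) (by norm_num)
  have h0 : 0 ≤ ∫ x in U, f x ^ 2 := integral_nonneg fun x => sq_nonneg _
  simp only [ENNReal.toReal_ofNat, Real.rpow_ofNat, Real.norm_eq_abs, sq_abs] at h
  rw [l2norm, h, ENNReal.toReal_ofReal (by positivity), ← Real.rpow_natCast, ← Real.rpow_mul h0]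
  norm_num

lemma memLp_comp_affine {a : Fin d → ℝ} {h : ℝ} (hh : 0 < h) {f : (Fin d → ℝ) → ℝ}
    (hf : MemLp f 2 (volume.restrict (cube a h))) :
    MemLp (fun x => f (a + h • x)) 2 (volume.restrict (unitCube d)) := by
  refine ((measurableEmbedding_affine a hh).memLp_map_measure_iff).1 ?_
  rw [map_affine_unitCube a hh]
  exact hf.smul_measure ENNReal.ofReal_ne_top

lemma l2norm_comp_affine_sq {a : Fin d → ℝ} {h : ℝ} (hh : 0 < h) {f : (Fin d → ℝ) → ℝ}
    (hf : MemLp f 2 (volume.restrict (cube a h))) :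
    l2norm (unitCube d) (fun x => f (a + h • x)) ^ 2 = (h ^ d)⁻¹ * l2norm (cube a h) f ^ 2 := by
  rw [l2norm_sq hf, l2norm_sq (memLp_comp_affine hh hf),
    integral_comp_affine a hh (fun y => f y ^ 2)]

instance isFiniteMeasure_restrict_cube (a : Fin d → ℝ) (h : ℝ) :
    IsFiniteMeasure (volume.restrict (cube a h)) :=
  ⟨by
    rw [Measure.restrict_apply_univ, cube, Real.volume_pi_Ioo]
    exact ENNReal.prod_lt_top fun _ _ => ENNReal.ofReal_lt_top⟩

instance isFiniteMeasure_restrict_unitCube : IsFiniteMeasure (volume.restrict (unitCube d)) :=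
  isFiniteMeasure_restrict_cube _ _

lemma memLp_of_continuous {f : (Fin d → ℝ) → ℝ} (hf : Continuous f) (a : Fin d → ℝ) (h : ℝ)  :
    MemLp f 2 (volume.restrict (cube a h)) := by
  have hsub : cube a h ⊆ Set.Icc a (fun i => a i + h) := fun x hx =>
    ⟨fun i => (hx i trivial).1.le, fun i => (hx i trivial).2.le⟩
  obtain ⟨C, hC⟩ := (isCompact_Icc (a := a) (b := fun i => a i + h)).exists_bound_of_continuousOn
    hf.continuousOn
  refine MemLp.of_bound hf.aestronglyMeasurable C ?_
  filter_upwards [ae_restrict_mem (isOpen_cube a h).measurableSet] with x hx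
  exact hC x (hsub hx)

/-! ### Membership in the Sobolev spaces -/

lemma memH_of_contDiff {p : (Fin d → ℝ) → ℝ} (hp : ContDiff ℝ ∞ p) (k : ℕ) (a : Fin d → ℝ)
    (h : ℝ) : MemH k (cube a h) p :=
  ⟨memLp_of_continuous hp.continuous a h, fun α _ =>
    ⟨_, hasWeakDeriv_mderiv hp α, memLp_of_continuous (contDiff_mderiv hp α).continuous a h⟩⟩

lemma MemH.congr {k : ℕ} {U : Set (Fin d → ℝ)} {u v : (Fin d → ℝ) → ℝ} (hu : MemH k U u)
    (h : u =ᵐ[volume.restrict U] v) : MemH k U v :=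
  ⟨(memLp_congr_ae h).1 hu.1, fun α hα =>
    let ⟨g, hg, hgm⟩ := hu.2 α hα
    ⟨g, hg.congr h EventuallyEq.rfl, hgm⟩⟩

lemma MemH.sub {k : ℕ} {U : Set (Fin d → ℝ)} {u v : (Fin d → ℝ) → ℝ} (hu : MemH k U u)
    (hv : MemH k U v) : MemH k U (u - v) :=
  ⟨hu.1.sub hv.1, fun α hα =>
    let ⟨g, hg, hgm⟩ := hu.2 α hα
    let ⟨g', hg', hgm'⟩ := hv.2 α hα
    ⟨g - g', hg.sub hg', hgm.sub hgm'⟩⟩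

lemma MemH.mono {k l : ℕ} {U V : Set (Fin d → ℝ)} {u : (Fin d → ℝ) → ℝ} (hu : MemH k U u)
    (hlk : l ≤ k) (hVU : V ⊆ U) : MemH l V u :=
  ⟨hu.1.mono_measure (Measure.restrict_mono hVU le_rfl), fun α hα =>
    let ⟨g, hg, hgm⟩ := hu.2 α (hα.trans hlk)
    ⟨g, hg.mono hVU, hgm.mono_measure (Measure.restrict_mono hVU le_rfl)⟩⟩

lemma MemH.comp_affine {k : ℕ} {a : Fin d → ℝ} {h : ℝ} (hh : 0 < h) {u : (Fin d → ℝ) → ℝ}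
    (hu : MemH k (cube a h) u) : MemH k (unitCube d) (fun x => u (a + h • x)) :=
  ⟨memLp_comp_affine hh hu.1, fun α hα =>
    let ⟨_, hg, hgm⟩ := hu.2 α hα
    ⟨_, hg.comp_affine hh, (memLp_comp_affine hh hgm).const_mul _⟩⟩

lemma MemH.hasWeakDeriv {k : ℕ} {U : Set (Fin d → ℝ)} {u : (Fin d → ℝ) → ℝ} (hu : MemH k U u)
    {α : Fin d → ℕ} (hα : ∑ i, α i ≤ k) : HasWeakDeriv U α u (weakDeriv U α u) := by
  have hex : ∃ g, HasWeakDeriv U α u g := let ⟨g, hg, _⟩ := hu.2 α hα; ⟨g, hg⟩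
  rw [weakDeriv, dif_pos hex]
  exact hex.choose_spec

lemma MemH.memLp_weakDeriv {k : ℕ} {U : Set (Fin d → ℝ)} (hU : IsOpen U)
    {u : (Fin d → ℝ) → ℝ} (hu : MemH k U u) {α : Fin d → ℕ} (hα : ∑ i, α i ≤ k) :
    MemLp (weakDeriv U α u) 2 (volume.restrict U) :=
  let ⟨_, hg, hgm⟩ := hu.2 α hα
  (memLp_congr_ae (hg.weakDeriv_ae_eq hU)).2 hgm

/-- Scaling of the norms of weak derivatives: on `cube a h` the square of the norm of a
derivative of order `k` is `h ^ (d - 2 k)` times that of the pull-back. -/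
lemma l2norm_weakDeriv_comp_affine_sq {k : ℕ} {a : Fin d → ℝ} {h : ℝ} (hh : 0 < h)
    {u : (Fin d → ℝ) → ℝ} (hu : MemH k (cube a h) u) {α : Fin d → ℕ} (hα : ∑ i, α i ≤ k) :
    l2norm (unitCube d) (weakDeriv (unitCube d) α (fun x => u (a + h • x))) ^ 2 =
      h ^ (2 * ∑ i, α i) * (h ^ d)⁻¹ * l2norm (cube a h) (weakDeriv (cube a h) α u) ^ 2 := by
  have h1 := (hu.hasWeakDeriv hα).comp_affine hh
  rw [l2norm_congr (h1.weakDeriv_ae_eq isOpen_unitCube)]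
  have h2 := l2norm_const_smul (unitCube d) (h ^ (∑ i, α i))
    (fun x => weakDeriv (cube a h) α u (a + h • x))
  rw [show (fun x => h ^ (∑ i, α i) * weakDeriv (cube a h) α u (a + h • x)) =
    h ^ (∑ i, α i) • (fun x => weakDeriv (cube a h) α u (a + h • x)) from rfl, h2, mul_pow, sq_abs,
    l2norm_comp_affine_sq hh (hu.memLp_weakDeriv (isOpen_cube a h) hα)]
  ring

/-! ### Duality between `L²` and test functions -/

lemma abs_integral_mul_le {U : Set (Fin d → ℝ)} {f g : (Fin d → ℝ) → ℝ}
    (hf : MemLp f 2 (volume.restrict U)) (hg : MemLp g 2 (volume.restrict U)) :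
    |∫ x in U, f x * g x| ≤ l2norm U f * l2norm U g := by
  have h1 := abs_real_inner_le_norm (hg.toLp g) (hf.toLp f)
  rw [L2.inner_def, Lp.norm_toLp, Lp.norm_toLp] at h1
  have h2 : ∫ x in U, f x * g x = ∫ x in U, inner ℝ (hg.toLp g x) (hf.toLp f x) := by
    refine integral_congr_ae ?_
    filter_upwards [hf.coeFn_toLp, hg.coeFn_toLp] with x h3 h4
    rw [h3, h4]
    simp
  rw [h2, mul_comm]
  exact h1

/-- Test functions are dense in `L²(U)`, so the norm of `L²(U)` is dual to them. -/
lemma l2norm_le_of_forall_isTest {U : Set (Fin d → ℝ)} (hU : IsOpen U) {F : (Fin d → ℝ) → ℝ}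
    (hF : MemLp F 2 (volume.restrict U)) {B : ℝ} (hB : 0 ≤ B)
    (h : ∀ φ, IsTest U φ → |∫ x in U, F x * φ x| ≤ B * l2norm U φ) : l2norm U F ≤ B := by
  let D : Submodule ℝ (Lp ℝ 2 (volume.restrict U)) :=
    Submodule.span ℝ {f | ∃ φ, ∃ hφ : IsTest U φ, f = (hφ.memLp _ 2).toLp φ}
  have hD : ∀ f ∈ D, ∃ φ, ∃ hφ : IsTest U φ, f = (hφ.memLp _ 2).toLp φ := by
    intro f hf
    induction hf using Submodule.span_induction with
    | mem f hf => exact hf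
    | zero =>
      refine ⟨0, ⟨contDiff_const, HasCompactSupport.zero, by simp⟩, ?_⟩
      exact (MemLp.toLp_zero _).symm
    | add f g _ _ hf hg =>
      obtain ⟨φ, hφ, rfl⟩ := hf
      obtain ⟨ψ, hψ, rfl⟩ := hg
      exact ⟨φ + ψ, hφ.add hψ, rfl⟩
    | smul c f _ hf =>
      obtain ⟨φ, hφ, rfl⟩ := hf
      exact ⟨fun x => c * φ x, hφ.const_mul c, rfl⟩
  have hdense : D.topologicalClosure = ⊤ := by
    rw [Submodule.topologicalClosure_eq_top_iff, Submodule.eq_bot_iff]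
    intro v hv
    have hloc : LocallyIntegrableOn v U :=
      locallyIntegrableOn_of_locallyIntegrable_restrict ((Lp.memLp v).locallyIntegrable (by norm_num))
    have h0 := hU.ae_eq_zero_of_integral_contDiff_smul_eq_zero hloc (μ := volume) ?_
    · rw [Lp.eq_zero_iff_ae_eq_zero, Filter.EventuallyEq, ae_restrict_iff' hU.measurableSet]
      exact h0
    · intro φ h1 h2 h3
      have hT : IsTest U φ := ⟨h1, h2, h3⟩
      rw [← setIntegral_eq_integral_of_forall_compl_eq_zero (s := U)
        (fun x hx => by rw [hT.eq_zero hx, zero_smul])]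
      have := (Submodule.mem_orthogonal _ _).1 hv _ (Submodule.subset_span ⟨φ, hT, rfl⟩)
      rw [L2.inner_def] at this
      rw [← this]
      refine integral_congr_ae ?_
      filter_upwards [(hT.memLp (volume.restrict U) 2).coeFn_toLp] with x hx
      rw [hx]
      simp [mul_comm]
  have hclosed : IsClosed {f : Lp ℝ 2 (volume.restrict U) | |inner ℝ (hF.toLp F) f| ≤ B * ‖f‖} :=
    isClosed_le (by fun_prop) (by fun_prop)
  have hall : hF.toLp F ∈
      {f : Lp ℝ 2 (volume.restrict U) | |inner ℝ (hF.toLp F) f| ≤ B * ‖f‖} := by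
    have hmem : hF.toLp F ∈ D.topologicalClosure := by rw [hdense]; trivial
    refine closure_minimal ?_ hclosed hmem
    intro f hf
    obtain ⟨φ, hφ, rfl⟩ := hD f hf
    simp only [Set.mem_ofPred_eq]
    rw [Lp.norm_toLp, L2.inner_def]
    refine (le_of_eq ?_).trans (h φ hφ)
    congr 1
    refine integral_congr_ae ?_
    filter_upwards [hF.coeFn_toLp, (hφ.memLp (volume.restrict U) 2).coeFn_toLp] with x h3 h4
    rw [h3, h4]
    simp [mul_comm]
  simp only [Set.mem_ofPred_eq] at hall
  rw [real_inner_self_eq_norm_sq, abs_of_nonneg (sq_nonneg _), sq] at hall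
  have hn : l2norm U F = ‖hF.toLp F‖ := by rw [Lp.norm_toLp]; rfl
  rw [hn]
  by_contra! hcon
  exact absurd (le_of_mul_le_mul_right hall (hB.trans_lt hcon)) (not_le.2 hcon)

/-! ### Integration in one coordinate -/

/-- The values of `g` on a line parallel to the `j`-th axis bound those of `f`, so the norm of
`g` bounds that of `f`. -/
lemma l2norm_le_of_le_lintegral_update (j : Fin d) {f g : (Fin d → ℝ) → ℝ} (hf : Continuous f)
    (hg : Continuous g)
    (h : ∀ x, ‖f x‖ₑ ≤ ∫⁻ t in Set.Ioo (0 : ℝ) 1, ‖g (Function.update x j t)‖ₑ) :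
    l2norm (unitCube d) f ≤ l2norm (unitCube d) g := by
  have hfin : eLpNorm g 2 (volume.restrict (unitCube d)) ≠ ⊤ := (memLp_of_continuous hg 0 1).2.ne
  refine ENNReal.toReal_mono hfin ?_
  have hprob : IsProbabilityMeasure (volume.restrict (Set.Ioo (0 : ℝ) 1)) := ⟨by simp⟩
  have hpi : volume.restrict (unitCube d) =
      Measure.pi (fun _ : Fin d => volume.restrict (Set.Ioo (0 : ℝ) 1)) := by
    rw [unitCube, cube, volume_pi, Measure.restrict_pi_pi]
    simp
  have hsq : ∀ {α : Type} [MeasurableSpace α] (μ : Measure α) (w : α → ℝ),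
      eLpNorm w 2 μ ^ 2 = ∫⁻ a, ‖w a‖ₑ ^ 2 ∂μ := by
    intro α _ μ w
    have := eLpNorm_nnreal_pow_eq_lintegral (μ := μ) (f := w) (p := 2) (by norm_num)
    simpa using this
  refine (ENNReal.pow_le_pow_left_iff (two_ne_zero)).1 ?_
  rw [hsq, hsq, hpi]
  refine lintegral_le_of_lmarginal_le {j} (by fun_prop) (by fun_prop) fun x => ?_
  rw [lmarginal_singleton, lmarginal_singleton]
  have hle : ∀ s : ℝ, ‖f (Function.update x j s)‖ₑ ^ 2 ≤
      ∫⁻ t in Set.Ioo (0 : ℝ) 1, ‖g (Function.update x j t)‖ₑ ^ 2 := by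
    intro s
    have h1 := h (Function.update x j s)
    simp only [Function.update_idem] at h1
    have hc : Continuous fun t => g (Function.update x j t) :=
      hg.comp (continuous_const.update j continuous_id)
    have h2 := eLpNorm_le_eLpNorm_of_exponent_le (μ := volume.restrict (Set.Ioo (0 : ℝ) 1))
      (p := 1) (q := 2) (by norm_num) hc.aestronglyMeasurable
    rw [eLpNorm_one_eq_lintegral_enorm] at h2
    calc _ ≤ _ := pow_le_pow_left₀ zero_le (h1.trans h2) 2
      _ = _ := hsq _ _
  calc _ ≤ ∫⁻ s in Set.Ioo (0 : ℝ) 1,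
        ∫⁻ t in Set.Ioo (0 : ℝ) 1, ‖g (Function.update x j t)‖ₑ ^ 2 := lintegral_mono fun s => hle s
    _ = _ := by rw [lintegral_const, measure_univ, mul_one]

/-- `f` vanishes unless all coordinates are at least `ε` away from `0` and `1`. -/
def VanishesNearBoundary (ε : ℝ) (f : (Fin d → ℝ) → ℝ) : Prop :=
  ∀ x i, (x i < ε ∨ 1 - ε < x i) → f x = 0

lemma IsTest.exists_vanishesNearBoundary {φ : (Fin d → ℝ) → ℝ} (hφ : IsTest (unitCube d) φ) :
    ∃ ε > 0, VanishesNearBoundary ε φ := by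
  obtain ⟨δ, hδ, hsub⟩ := hφ.compact.exists_thickening_subset_open isOpen_unitCube hφ.supp
  refine ⟨δ / 2, by positivity, fun x i hx => image_eq_zero_of_notMem_tsupport fun hmem => ?_⟩
  have key : ∀ y : ℝ, |y - x i| < δ → 0 < y ∧ y < 1 := by
    intro y hy
    have : Function.update x i y ∈ Metric.thickening δ (tsupport φ) := by
      rw [Metric.mem_thickening_iff]
      refine ⟨x, hmem, (dist_pi_lt_iff hδ).2 fun k => ?_⟩
      by_cases hk : k = i
      · subst hk; simpa [Real.dist_eq] using hy
      · simpa [hk] using hδ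
    simpa using mem_unitCube.1 (hsub this) i
  have h1 := key (x i - δ / 2) (by rw [abs_lt]; constructor <;> linarith)
  have h2 := key (x i + δ / 2) (by rw [abs_lt]; constructor <;> linarith)
  rcases hx with hx | hx <;> linarith [h1.1, h2.2]

lemma isTest_of_vanishesNearBoundary {φ : (Fin d → ℝ) → ℝ} (hφ : ContDiff ℝ ∞ φ) {ε : ℝ}
    (hε : 0 < ε) (h : VanishesNearBoundary ε φ) : IsTest (unitCube d) φ := by
  have hsub : tsupport φ ⊆ Set.Icc (fun _ => ε) (fun _ => 1 - ε) := by
    refine closure_minimal (fun x hx => ?_) isClosed_Icc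
    refine ⟨fun i => ?_, fun i => ?_⟩ <;> by_contra! hcon
    · exact hx (h x i (Or.inl hcon))
    · exact hx (h x i (Or.inr hcon))
  refine ⟨hφ, isCompact_Icc.of_isClosed_subset (isClosed_tsupport _) hsub, fun x hx => ?_⟩
  have := hsub hx
  exact mem_unitCube.2 fun i => ⟨hε.trans_le (this.1 i), (this.2 i).trans_lt (by linarith)⟩

/-- Smoothness of integrals `∫ k (x_j - t) φ (x with x_j replaced by t) dt`. -/
lemma contDiff_integral_update {φ : (Fin d → ℝ) → ℝ} (hφ : IsTest (unitCube d) φ) (j : Fin d)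
    {k : ℝ → ℝ} (hk : LocallyIntegrable k) :
    ContDiff ℝ ∞ fun x : Fin d → ℝ => ∫ t, k (x j - t) * φ (Function.update x j t) := by
  have hup : ContDiff ℝ ∞ fun q : (Fin d → ℝ) × ℝ => Function.update q.1 j q.2 := by
    rw [contDiff_pi]
    intro i
    by_cases hi : i = j
    · subst hi; simpa using contDiff_snd
    · simp only [ne_eq, hi, not_false_eq_true, Function.update_of_ne]
      fun_prop
  have h := contDiffOn_convolution_right_with_param (𝕜 := ℝ) (P := Fin d → ℝ) (G := ℝ)
    (μ := volume) (n := ⊤) (f := k) (ContinuousLinearMap.mul ℝ ℝ)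
    (g := fun p t => φ (Function.update p j t)) (s := Set.univ) (k := Set.Icc (0 : ℝ) 1)
    isOpen_univ isCompact_Icc ?_ hk ((hφ.smooth.comp hup).contDiffOn)
  · rw [Set.univ_prod_univ, contDiffOn_univ] at h
    have h2 := h.comp (contDiff_id.prodMk (contDiff_apply ℝ ℝ j))
    convert h2 using 1
    funext x
    simp only [Function.comp, id]
    rw [convolution_eq_swap]
    rfl
  · intro p t _ ht
    refine hφ.eq_zero fun hmem => ht ?_
    have := mem_unitCube.1 hmem j
    rw [Function.update_self] at this
    exact ⟨this.1.le, this.2.le⟩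

/-! ### The Poincaré inequality -/

lemma IsTest.update_eq_zero {φ : (Fin d → ℝ) → ℝ} (hφ : IsTest (unitCube d) φ) (x : Fin d → ℝ)
    (j : Fin d) {t : ℝ} (ht : t ∉ Set.Ioo (0 : ℝ) 1) : φ (Function.update x j t) = 0 := by
  refine hφ.eq_zero fun hmem => ht ?_
  simpa using mem_unitCube.1 hmem j

lemma IsTest.continuous_update {φ : (Fin d → ℝ) → ℝ} (hφ : IsTest (unitCube d) φ)
    (x : Fin d → ℝ) (j : Fin d) : Continuous fun t => φ (Function.update x j t) :=
  hφ.continuous.comp (continuous_const.update j continuous_id)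

lemma IsTest.integrable_update {φ : (Fin d → ℝ) → ℝ} (hφ : IsTest (unitCube d) φ)
    (x : Fin d → ℝ) (j : Fin d) : Integrable fun t => φ (Function.update x j t) :=
  (hφ.continuous_update x j).integrable_of_hasCompactSupport
    (HasCompactSupport.intro (isCompact_Icc (a := (0 : ℝ)) (b := 1)) fun _ ht =>
      hφ.update_eq_zero x j fun h => ht ⟨h.1.le, h.2.le⟩)

/-- The integral of `φ` over the line through `x` parallel to the `j`-th axis. -/
noncomputable def lineIntegral (j : Fin d) (φ : (Fin d → ℝ) → ℝ) (x : Fin d → ℝ) : ℝ :=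
  ∫ t, φ (Function.update x j t)

/-- The primitive of `φ` in the `j`-th coordinate that vanishes for `x j = -∞`. -/
noncomputable def linePrimitive (j : Fin d) (φ : (Fin d → ℝ) → ℝ) (x : Fin d → ℝ) : ℝ :=
  ∫ t in Set.Iic (x j), φ (Function.update x j t)

lemma contDiff_lineIntegral {φ : (Fin d → ℝ) → ℝ} (hφ : IsTest (unitCube d) φ) (j : Fin d) :
    ContDiff ℝ ∞ (lineIntegral j φ) := by
  have := contDiff_integral_update hφ j (k := fun _ => 1) (locallyIntegrable_const _)
  simp only [one_mul] at this
  exact this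

lemma contDiff_linePrimitive {φ : (Fin d → ℝ) → ℝ} (hφ : IsTest (unitCube d) φ) (j : Fin d) :
    ContDiff ℝ ∞ (linePrimitive j φ) := by
  have := contDiff_integral_update hφ j (k := (Set.Ici 0).indicator fun _ => 1)
    ((locallyIntegrable_const _).indicator measurableSet_Ici)
  convert this using 1
  funext x
  rw [linePrimitive, ← integral_indicator measurableSet_Iic]
  congr 1
  funext t
  by_cases ht : t ≤ x j
  · rw [Set.indicator_of_mem (by exact ht), Set.indicator_of_mem (by simpa using ht), one_mul]
  · rw [Set.indicator_of_notMem (by exact ht), Set.indicator_of_notMem (by simpa using ht),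
      zero_mul]

lemma enorm_lineIntegral_le {φ : (Fin d → ℝ) → ℝ} (hφ : IsTest (unitCube d) φ) (j : Fin d)
    (x : Fin d → ℝ) :
    ‖lineIntegral j φ x‖ₑ ≤ ∫⁻ t in Set.Ioo (0 : ℝ) 1, ‖φ (Function.update x j t)‖ₑ := by
  rw [lineIntegral, ← setIntegral_eq_integral_of_forall_compl_eq_zero
    fun t ht => hφ.update_eq_zero x j ht]
  exact enorm_integral_le_lintegral_enorm _

lemma enorm_linePrimitive_le {φ : (Fin d → ℝ) → ℝ} (hφ : IsTest (unitCube d) φ) (j : Fin d)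
    (x : Fin d → ℝ) :
    ‖linePrimitive j φ x‖ₑ ≤ ∫⁻ t in Set.Ioo (0 : ℝ) 1, ‖φ (Function.update x j t)‖ₑ := by
  refine (enorm_integral_le_lintegral_enorm _).trans ((setLIntegral_le_lintegral _ _).trans_eq ?_)
  rw [← lintegral_indicator measurableSet_Ioo]
  congr 1
  funext t
  by_cases ht : t ∈ Set.Ioo (0 : ℝ) 1
  · rw [Set.indicator_of_mem ht]
  · rw [Set.indicator_of_notMem ht, hφ.update_eq_zero x j ht, enorm_zero]

lemma pderiv_linePrimitive {φ : (Fin d → ℝ) → ℝ} (hφ : IsTest (unitCube d) φ) (j : Fin d) :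
    pderiv j (linePrimitive j φ) = φ := by
  funext x
  have h1 : HasDerivAt (fun s => linePrimitive j φ (Function.update x j s))
      (pderiv j (linePrimitive j φ) x) (x j) := by
    have hd : HasFDerivAt (linePrimitive j φ) (fderiv ℝ (linePrimitive j φ) x)
        (Function.update x j (x j)) := by
      rw [Function.update_eq_self]
      exact ((contDiff_linePrimitive hφ j).differentiable (by simp) x).hasFDerivAt
    exact hd.comp_hasDerivAt (x j) (hasDerivAt_update x j (x j))
  have h2 : HasDerivAt (fun s => linePrimitive j φ (Function.update x j s)) (φ x) (x j) := by
    have e : (fun s => linePrimitive j φ (Function.update x j s)) = fun s =>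
        (∫ t in Set.Iic (0 : ℝ), φ (Function.update x j t)) +
          ∫ t in (0 : ℝ)..s, φ (Function.update x j t) := by
      funext s
      have hi := hφ.integrable_update x j
      rw [← intervalIntegral.integral_Iic_sub_Iic hi.integrableOn hi.integrableOn]
      simp [linePrimitive]
    rw [e]
    have := ((hφ.continuous_update x j).integral_hasStrictDerivAt 0 (x j)).hasDerivAt
    rw [Function.update_eq_self] at this
    exact this.const_add _
  exact h1.unique h2

lemma IsTest.linePrimitive {φ : (Fin d → ℝ) → ℝ} (hφ : IsTest (unitCube d) φ) {j : Fin d}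
    (h0 : lineIntegral j φ = 0) : IsTest (unitCube d) (linePrimitive j φ) := by
  obtain ⟨ε, hε, hv⟩ := hφ.exists_vanishesNearBoundary
  refine isTest_of_vanishesNearBoundary (contDiff_linePrimitive hφ j) hε fun x i hx => ?_
  by_cases hij : i = j
  · subst hij
    rcases hx with hx | hx
    · refine setIntegral_eq_zero_of_forall_eq_zero fun t ht => hv _ i (Or.inl ?_)
      rw [Function.update_self]
      exact lt_of_le_of_lt ht hx
    · refine Eq.trans ?_ (congrFun h0 x)
      refine setIntegral_eq_integral_of_forall_compl_eq_zero fun t ht => hv _ i (Or.inr ?_)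
      rw [Function.update_self]
      exact hx.trans (not_le.1 ht)
  · refine setIntegral_eq_zero_of_forall_eq_zero fun t _ => hv _ i ?_
    rwa [Function.update_of_ne hij]

/-- A smooth bump function in one variable, of integral one and with support in
`[1/4, 3/4]`. -/
lemma exists_bump : ∃ ρ : ℝ → ℝ, ContDiff ℝ ∞ ρ ∧ (∀ t, t < 1 / 4 ∨ 3 / 4 < t → ρ t = 0) ∧
    ∫ t, ρ t = 1 := by
  let f : ContDiffBump (1 / 2 : ℝ) := ⟨1 / 8, 1 / 4, by norm_num, by norm_num⟩
  refine ⟨f.normed volume, f.contDiff_normed, fun t ht => ?_, f.integral_normed⟩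
  have : t ∉ Function.support (f.normed volume) := by
    rw [f.support_normed_eq, Metric.mem_ball, Real.dist_eq, not_lt]
    change (1 / 4 : ℝ) ≤ _
    rw [le_abs]
    rcases ht with ht | ht
    · right; linarith
    · left; linarith
  simpa using this

/-- Replacing a test function by `ρ (x_j)` times its integral in the `j`-th coordinate changes
it by the `j`-th derivative of a test function. Tested against a function in `L²`, the change is
therefore controlled by the `j`-th weak derivative. -/
lemma exists_average_coordinate {ρ : ℝ → ℝ} (hρ : ContDiff ℝ ∞ ρ)
    (hρs : ∀ t, t < 1 / 4 ∨ 3 / 4 < t → ρ t = 0) (hρi : ∫ t, ρ t = 1) (j : Fin d) :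
    ∃ C : ℝ, 0 ≤ C ∧ ∀ φ : (Fin d → ℝ) → ℝ, IsTest (unitCube d) φ →
      IsTest (unitCube d) (fun x => ρ (x j) * lineIntegral j φ x) ∧
      l2norm (unitCube d) (fun x => ρ (x j) * lineIntegral j φ x) ≤ C * l2norm (unitCube d) φ ∧
      ∀ f g : (Fin d → ℝ) → ℝ, HasWeakDeriv (unitCube d) (Pi.single j 1) f g →
        MemLp g 2 (volume.restrict (unitCube d)) →
        |(∫ x in unitCube d, f x * φ x) -
            ∫ x in unitCube d, f x * (ρ (x j) * lineIntegral j φ x)| ≤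
          C * l2norm (unitCube d) g * l2norm (unitCube d) φ := by
  have hρc : HasCompactSupport ρ := HasCompactSupport.intro
    (isCompact_Icc (a := (1 / 4 : ℝ)) (b := 3 / 4)) fun t ht => hρs t (by
      by_contra! hcon
      exact ht ⟨hcon.1, hcon.2⟩)
  obtain ⟨M, hM⟩ := hρc.exists_bound_of_continuous hρ.continuous
  have hM0 : 0 ≤ M := (norm_nonneg _).trans (hM 0)
  refine ⟨1 + M, by positivity, fun φ hφ => ?_⟩
  set ψ : (Fin d → ℝ) → ℝ := fun x => ρ (x j) * lineIntegral j φ x with hψdef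
  have hψ : IsTest (unitCube d) ψ := by
    obtain ⟨ε, hε, hv⟩ := hφ.exists_vanishesNearBoundary
    refine isTest_of_vanishesNearBoundary
      ((hρ.comp (contDiff_apply ℝ ℝ j)).mul (contDiff_lineIntegral hφ j))
      (ε := min ε (1 / 4)) (by positivity) fun x i hx => ?_
    by_cases hij : i = j
    · subst hij
      have : ρ (x i) = 0 := hρs _ (by
        have := min_le_right ε (1 / 4)
        rcases hx with hx | hx
        · left; linarith
        · right; linarith)
      simp [hψdef, this]
    · have : lineIntegral j φ x = 0 := by
        unfold lineIntegral
        have h0 : ∀ t, φ (Function.update x j t) = 0 := fun t => hv _ i (by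
          rw [Function.update_of_ne hij]
          have := min_le_left ε (1 / 4)
          rcases hx with hx | hx
          · left; linarith
          · right; linarith)
        simp [h0]
      simp [hψdef, this]
  have hψn : l2norm (unitCube d) ψ ≤ M * l2norm (unitCube d) φ := by
    have h1 : l2norm (unitCube d) (lineIntegral j φ) ≤ l2norm (unitCube d) φ :=
      l2norm_le_of_le_lintegral_update j (contDiff_lineIntegral hφ j).continuous hφ.continuous
        (enorm_lineIntegral_le hφ j)
    have h2 : l2norm (unitCube d) ψ ≤ l2norm (unitCube d) (M • lineIntegral j φ) := by
      refine ENNReal.toReal_mono ?_ (eLpNorm_mono fun x => ?_)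
      · exact ((memLp_of_continuous (contDiff_lineIntegral hφ j).continuous 0 1).const_smul M).2.ne
      · rw [Pi.smul_apply, norm_smul, hψdef, norm_mul, Real.norm_of_nonneg hM0]
        exact mul_le_mul_of_nonneg_right (hM _) (norm_nonneg _)
    rw [l2norm_const_smul, abs_of_nonneg hM0] at h2
    exact h2.trans (mul_le_mul_of_nonneg_left h1 hM0)
  refine ⟨hψ, hψn.trans (mul_le_mul_of_nonneg_right (by linarith) (l2norm_nonneg _ _)),
    fun f g hfg hg => ?_⟩
  have hχ : IsTest (unitCube d) (φ - ψ) := hφ.sub hψ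
  have hχ0 : lineIntegral j (φ - ψ) = 0 := by
    funext x
    have e : ∀ t, ψ (Function.update x j t) = ρ t * lineIntegral j φ x := fun t => by
      simp [hψdef, lineIntegral]
    have hi := hψ.integrable_update x j
    simp only [lineIntegral, Pi.sub_apply]
    rw [integral_sub (hφ.integrable_update x j) hi]
    simp only [e, integral_mul_const, hρi, one_mul]
    exact sub_self _
  -- the difference integrates to zero on each line, so its primitive has compact support
  have hΦ := hχ.linePrimitive hχ0
  have hχn : l2norm (unitCube d) (φ - ψ) ≤ (1 + M) * l2norm (unitCube d) φ := by
    have h1 := l2norm_add_le (hφ.memLp (volume.restrict (unitCube d)) 2)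
      ((hψ.memLp (volume.restrict (unitCube d)) 2).const_smul (-1 : ℝ))
    rw [l2norm_const_smul] at h1
    have h2 : φ - ψ = φ + (-1 : ℝ) • ψ := by simp [sub_eq_add_neg]
    rw [h2]
    rw [abs_neg, abs_one, one_mul] at h1
    linarith
  have hΦn : l2norm (unitCube d) (linePrimitive j (φ - ψ)) ≤ l2norm (unitCube d) (φ - ψ) :=
    l2norm_le_of_le_lintegral_update j hΦ.continuous hχ.continuous (enorm_linePrimitive_le hχ j)
  have h1 := hfg.2.2 _ hΦ.smooth hΦ.compact hΦ.supp
  rw [mderiv_single hΦ.smooth, pderiv_linePrimitive hχ, Finset.sum_pi_single',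
    if_pos (Finset.mem_univ j), pow_one] at h1
  have h2 : (∫ x in unitCube d, f x * φ x) - ∫ x in unitCube d, f x * ψ x =
      ∫ x in unitCube d, f x * (φ - ψ) x := by
    rw [← integral_sub (hφ.integrable_mul hfg.1) (hψ.integrable_mul hfg.1)]
    simp only [Pi.sub_apply, mul_sub]
  have h3 : |(∫ x in unitCube d, f x * φ x) - ∫ x in unitCube d, f x * ψ x| =
      |∫ x in unitCube d, g x * linePrimitive j (φ - ψ) x| := by
    rw [h2, h1, abs_mul, abs_neg, abs_one, one_mul]
  rw [h3]
  refine (abs_integral_mul_le hg (hΦ.memLp _ 2)).trans ?_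
  rw [mul_comm (1 + M), mul_assoc]
  exact mul_le_mul_of_nonneg_left (hΦn.trans hχn) (l2norm_nonneg _ _)

/-- Averaging over the coordinates in `s`, one after the other: the result is a product of bumps
in these coordinates times a function of the others. -/
lemma exists_average_coordinates {ρ : ℝ → ℝ} (hρ : ContDiff ℝ ∞ ρ)
    (hρs : ∀ t, t < 1 / 4 ∨ 3 / 4 < t → ρ t = 0) (hρi : ∫ t, ρ t = 1) (s : Finset (Fin d)) :
    ∃ C : ℝ, 0 ≤ C ∧ ∀ φ : (Fin d → ℝ) → ℝ, IsTest (unitCube d) φ →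
      ∃ ψ m : (Fin d → ℝ) → ℝ, IsTest (unitCube d) ψ ∧
        (∀ x, ψ x = (∏ i ∈ s, ρ (x i)) * m x) ∧
        (∀ i ∈ s, ∀ x t, m (Function.update x i t) = m x) ∧
        l2norm (unitCube d) ψ ≤ C * l2norm (unitCube d) φ ∧
        ∀ (f : (Fin d → ℝ) → ℝ) (g : Fin d → (Fin d → ℝ) → ℝ),
          (∀ i, HasWeakDeriv (unitCube d) (Pi.single i 1) f (g i)) →
          (∀ i, MemLp (g i) 2 (volume.restrict (unitCube d))) →
          |(∫ x in unitCube d, f x * φ x) - ∫ x in unitCube d, f x * ψ x| ≤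
            C * (∑ i, l2norm (unitCube d) (g i)) * l2norm (unitCube d) φ := by
  induction s using Finset.induction_on with
  | empty =>
    refine ⟨1, zero_le_one, fun φ hφ => ⟨φ, φ, hφ, by simp, by simp, by simp, fun f g _ _ => ?_⟩⟩
    rw [sub_self, abs_zero]
    have hG : 0 ≤ ∑ i, l2norm (unitCube d) (g i) := Finset.sum_nonneg fun i _ => l2norm_nonneg _ _
    exact mul_nonneg (mul_nonneg zero_le_one hG) (l2norm_nonneg _ _)
  | insert j s hj ih =>
    obtain ⟨C₁, hC₁, h₁⟩ := ih
    obtain ⟨C₂, hC₂, h₂⟩ := exists_average_coordinate hρ hρs hρi j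
    refine ⟨C₁ + C₂ * C₁, by positivity, fun φ hφ => ?_⟩
    obtain ⟨ψ, m, hψ, hψm, hm, hn, hf⟩ := h₁ φ hφ
    obtain ⟨hT, hn', hf'⟩ := h₂ ψ hψ
    have hφ0 := l2norm_nonneg (unitCube d) φ
    refine ⟨fun x => ρ (x j) * lineIntegral j ψ x, lineIntegral j m, hT, fun x => ?_,
      fun i hi x t => ?_, ?_, fun f g hfg hg => ?_⟩
    · have : lineIntegral j ψ x = (∏ i ∈ s, ρ (x i)) * lineIntegral j m x := by
        unfold lineIntegral
        rw [← integral_const_mul]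
        congr 1
        funext t
        rw [hψm]
        congr 1
        refine Finset.prod_congr rfl fun i hi => ?_
        rw [Function.update_of_ne (ne_of_mem_of_not_mem hi hj)]
      simp only [this]
      rw [Finset.prod_insert hj, mul_assoc]
    · unfold lineIntegral
      congr 1
      funext t'
      by_cases hij : i = j
      · subst hij; rw [Function.update_idem]
      · rw [Function.update_comm hij]
        exact hm i ((Finset.mem_insert.1 hi).resolve_left hij) _ _
    · calc _ ≤ _ := hn'
        _ ≤ C₂ * (C₁ * l2norm (unitCube d) φ) := mul_le_mul_of_nonneg_left hn hC₂
        _ = C₂ * C₁ * l2norm (unitCube d) φ := by ring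
        _ ≤ _ := mul_le_mul_of_nonneg_right (by linarith) hφ0
    · have e1 := hf f g hfg hg
      have e2 := hf' f (g j) (hfg j) (hg j)
      have e3 : l2norm (unitCube d) (g j) ≤ ∑ i, l2norm (unitCube d) (g i) :=
        Finset.single_le_sum (f := fun i => l2norm (unitCube d) (g i))
          (fun i _ => l2norm_nonneg _ _) (Finset.mem_univ j)
      have e4 : C₂ * l2norm (unitCube d) (g j) * l2norm (unitCube d) ψ ≤
          C₂ * (∑ i, l2norm (unitCube d) (g i)) * (C₁ * l2norm (unitCube d) φ) :=
        mul_le_mul (mul_le_mul_of_nonneg_left e3 hC₂) hn (l2norm_nonneg _ _)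
          (mul_nonneg hC₂ ((l2norm_nonneg _ _).trans e3))
      calc _ ≤ _ := abs_sub_le _ (∫ x in unitCube d, f x * ψ x) _
        _ ≤ _ := add_le_add e1 (e2.trans e4)
        _ = _ := by ring

/-- A function that does not depend on any single coordinate is constant. -/
lemma eq_of_forall_update_eq {m : (Fin d → ℝ) → ℝ}
    (h : ∀ i x t, m (Function.update x i t) = m x) (x y : Fin d → ℝ) : m x = m y := by
  have key : ∀ s : Finset (Fin d), m (s.piecewise x y) = m y := by
    intro s
    induction s using Finset.induction_on with
    | empty => rw [Finset.piecewise_empty]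
    | insert j s _ ih => rw [Finset.piecewise_insert, h, ih]
  simpa using key Finset.univ

/-- The Poincaré inequality on the unit cube. -/
theorem exists_poincare (d : ℕ) : ∃ C : ℝ, 0 ≤ C ∧ ∀ (f : (Fin d → ℝ) → ℝ)
    (g : Fin d → (Fin d → ℝ) → ℝ), MemLp f 2 (volume.restrict (unitCube d)) →
    (∀ i, HasWeakDeriv (unitCube d) (Pi.single i 1) f (g i)) →
    (∀ i, MemLp (g i) 2 (volume.restrict (unitCube d))) →
    ∃ c : ℝ, l2norm (unitCube d) (fun x => f x - c) ≤ C * ∑ i, l2norm (unitCube d) (g i) := by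
  obtain ⟨ρ, hρ, hρs, hρi⟩ := exists_bump
  obtain ⟨C, hC, h⟩ := exists_average_coordinates (d := d) hρ hρs hρi Finset.univ
  refine ⟨C, hC, fun f g hf hfg hg => ⟨∫ x in unitCube d, f x * ∏ i, ρ (x i), ?_⟩⟩
  have hG : 0 ≤ ∑ i, l2norm (unitCube d) (g i) := Finset.sum_nonneg fun i _ => l2norm_nonneg _ _
  set c := ∫ x in unitCube d, f x * ∏ i, ρ (x i) with hc
  refine l2norm_le_of_forall_isTest isOpen_unitCube (hf.sub (memLp_const c)) (by positivity)
    fun φ hφ => ?_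
  obtain ⟨ψ, m, hψ, hψm, hm, -, hfφ⟩ := h φ hφ
  -- after averaging in all coordinates, only a constant factor is left
  have hψ' : ∀ x, ψ x = (∏ i, ρ (x i)) * m 0 := fun x => by
    rw [hψm, eq_of_forall_update_eq (fun i => hm i (Finset.mem_univ i)) x 0]
  have hR : ∫ x in unitCube d, ∏ i, ρ (x i) = 1 := by
    rw [setIntegral_eq_integral_of_forall_compl_eq_zero]
    · rw [integral_fintype_prod_volume_eq_prod (fun _ : Fin d => ρ)]
      simp [hρi]
    · intro x hx
      rw [mem_unitCube] at hx
      push Not at hx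
      obtain ⟨i, hi⟩ := hx
      refine Finset.prod_eq_zero (Finset.mem_univ i) (hρs _ ?_)
      by_cases h0 : 0 < x i
      · right; linarith [hi h0]
      · left; linarith
  -- averaging preserves the integral, which the constant function `1` detects
  have hm0 : ∫ x in unitCube d, φ x = m 0 := by
    have hone : ∀ i : Fin d, HasWeakDeriv (unitCube d) (Pi.single i 1) (fun _ => (1 : ℝ)) 0 := by
      intro i
      have := hasWeakDeriv_pderiv (U := unitCube d) (p := fun _ => (1 : ℝ)) contDiff_const i
      rwa [show pderiv i (fun _ => (1 : ℝ)) = 0 by funext x; simp [pderiv]] at this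
    have e := hfφ (fun _ => 1) (fun _ => 0) hone (fun _ => MemLp.zero)
    have z : l2norm (unitCube d) 0 = 0 := by simp [l2norm]
    simp only [z, Finset.sum_const_zero, mul_zero, zero_mul, one_mul, hψ', integral_mul_const,
      hR] at e
    linarith [abs_nonpos_iff.1 e]
  have e := hfφ f g hfg hg
  have hfL : LocallyIntegrableOn f (unitCube d) :=
    locallyIntegrableOn_of_locallyIntegrable_restrict (hf.locallyIntegrable (by norm_num))
  have e1 : ∫ x in unitCube d, f x * ψ x = c * m 0 := by
    simp only [hψ', ← mul_assoc, integral_mul_const, hc]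
  have e2 : ∫ x in unitCube d, (f x - c) * φ x = (∫ x in unitCube d, f x * φ x) - c * m 0 := by
    simp only [sub_mul]
    rw [integral_sub (hφ.integrable_mul hfL)
      (hφ.integrable_mul (locallyIntegrableOn_const c)), integral_const_mul, hm0]
  rw [← e1] at e2
  exact (congrArg abs e2).trans_le e

/-! ### Polynomials -/

/-- The function on `ℝ^d` given by a polynomial. -/
noncomputable def polyFun (p : MvPolynomial (Fin d) ℝ) : (Fin d → ℝ) → ℝ := fun x => MvPolynomial.eval x p

lemma polyFun_add (p q : MvPolynomial (Fin d) ℝ) : polyFun (p + q) = polyFun p + polyFun q := by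
  funext x
  simp [polyFun]

lemma polyFun_zero : polyFun (0 : MvPolynomial (Fin d) ℝ) = 0 := by
  funext x
  simp [polyFun]

lemma polyFun_C (a : ℝ) : polyFun (MvPolynomial.C a : MvPolynomial (Fin d) ℝ) = fun _ => a := by
  funext x
  simp [polyFun]

lemma contDiff_polyFun (p : MvPolynomial (Fin d) ℝ) : ContDiff ℝ ∞ (polyFun p) := by
  induction p using MvPolynomial.induction_on with
  | C a => rw [polyFun_C]; exact contDiff_const
  | add p q hp hq => rw [polyFun_add]; exact hp.add hq
  | mul_X p i hp =>
    have : polyFun (p * MvPolynomial.X i) = fun x => polyFun p x * x i := by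
      funext x
      simp [polyFun]
    rw [this]
    exact hp.mul (contDiff_apply ℝ ℝ i)

lemma pderiv_polyFun (p : MvPolynomial (Fin d) ℝ) (j : Fin d) :
    pderiv j (polyFun p) = polyFun (MvPolynomial.pderiv j p) := by
  induction p using MvPolynomial.induction_on with
  | C a =>
    funext x
    rw [MvPolynomial.pderiv_C, polyFun_zero, polyFun_C]
    simp [pderiv]
  | add p q hp hq =>
    rw [polyFun_add, pderiv_add (contDiff_polyFun p) (contDiff_polyFun q), hp, hq, map_add,
      polyFun_add]
  | mul_X p i hp =>
    have h1 : polyFun (p * MvPolynomial.X i) = fun x => polyFun p x * x i := by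
      funext x
      simp [polyFun]
    funext x
    have h2 : HasFDerivAt (fun x : Fin d → ℝ => polyFun p x * x i)
        (polyFun p x • ContinuousLinearMap.proj (R := ℝ) (φ := fun _ : Fin d => ℝ) i +
          x i • fderiv ℝ (polyFun p) x) x :=
      ((contDiff_polyFun p).differentiable (by simp) x).hasFDerivAt.mul
        (hasFDerivAt_apply i x)
    have h3 : fderiv ℝ (polyFun p) x (Pi.single j 1) = polyFun (MvPolynomial.pderiv j p) x :=
      congrFun hp x
    rw [h1, pderiv, h2.fderiv]
    simp only [add_apply, smul_apply, h3,
      ContinuousLinearMap.proj_apply, smul_eq_mul, polyFun, Derivation.leibniz, map_add,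
      MvPolynomial.pderiv_X, map_mul, MvPolynomial.eval_X]
    congr 2
    by_cases hij : i = j
    · subst hij; simp
    · simp [hij]

/-- The derivatives of a monomial of order at least its degree are constants. -/
lemma mderiv_monomial (β : Fin d → ℕ) (s : Fin d →₀ ℕ) (c : ℝ) (hs : ∑ i, s i ≤ ∑ i, β i) :
    mderiv β (polyFun (MvPolynomial.monomial s c)) =
      fun _ => if ⇑s = β then c * ∏ i, ((β i).factorial : ℝ) else 0 := by
  induction β using multiIndex_induction generalizing s c with
  | h0 =>
    have : s = 0 := by
      ext i
      have h := Finset.sum_eq_zero_iff.1 (Nat.le_zero.1 (hs.trans (by simp))) i (Finset.mem_univ i)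
      simpa using h
    subst this
    funext x
    simp [polyFun]
  | hs β j ih =>
    rw [mderiv_add_single (contDiff_polyFun _), ← mderiv_pderiv (contDiff_polyFun _),
      pderiv_polyFun, MvPolynomial.pderiv_monomial]
    by_cases hsj : s j = 0
    · have hne : ⇑s ≠ β + Pi.single j 1 := fun h => by
        have := congrFun h j
        simp [hsj] at this
      rw [hsj, if_neg hne]
      simp only [Nat.cast_zero, mul_zero, map_zero, polyFun_zero, mderiv_zero_fun]
      rfl
    · have hs' : s = (s - Finsupp.single j 1) + Finsupp.single j 1 := by
        ext i
        by_cases hij : i = j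
        · subst hij; simp; omega
        · simp [Ne.symm hij]
      set t := s - Finsupp.single j 1 with ht
      have hst : ⇑s = ⇑t + Pi.single j 1 := by
        rw [hs']
        funext i
        simp [Finsupp.single_apply, Pi.single_apply, eq_comm]
      have hle : ∑ i, t i ≤ ∑ i, β i := by
        rw [hst, sum_add_single, sum_add_single] at hs
        omega
      rw [ih t _ hle, hst]
      funext x
      simp only [add_left_inj]
      by_cases htβ : ⇑t = β
      · rw [if_pos htβ, if_pos htβ, htβ, mul_assoc]
        congr 1
        have : ∀ i, (((β + Pi.single j 1 : Fin d → ℕ) i).factorial : ℝ) =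
            (β i).factorial * if i = j then ((β j : ℝ) + 1) else 1 := by
          intro i
          by_cases hij : i = j
          · subst hij; simp [Nat.factorial_succ, mul_comm]
          · simp [hij]
        rw [Finset.prod_congr rfl fun i _ => this i, Finset.prod_mul_distrib,
          Finset.prod_ite_eq' Finset.univ j, if_pos (Finset.mem_univ j), mul_comm]
        simp
      · rw [if_neg htβ, if_neg htβ]

lemma sum_le_totalDegree {p : MvPolynomial (Fin d) ℝ} {s : Fin d →₀ ℕ} (hs : s ∈ p.support) :
    ∑ i, s i ≤ p.totalDegree := by
  have := MvPolynomial.le_totalDegree hs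
  rwa [Finsupp.sum_fintype _ _ (fun _ => rfl)] at this

lemma totalDegree_monomial_le (s : Fin d →₀ ℕ) (c : ℝ) :
    (MvPolynomial.monomial s c).totalDegree ≤ ∑ i, s i := by
  refine (MvPolynomial.totalDegree_monomial_le s c).trans_eq ?_
  rw [Finsupp.sum_fintype _ _ (fun _ => rfl)]
  rfl

lemma polyFun_sum {ι : Type*} (s : Finset ι) (p : ι → MvPolynomial (Fin d) ℝ) :
    polyFun (∑ i ∈ s, p i) = ∑ i ∈ s, polyFun (p i) := by
  funext x
  simp [polyFun]

lemma mderiv_polyFun_eq_zero {p : MvPolynomial (Fin d) ℝ} {β : Fin d → ℕ}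
    (h : p.totalDegree < ∑ i, β i) : mderiv β (polyFun p) = 0 := by
  rw [p.as_sum, polyFun_sum, mderiv_sum _ fun _ => contDiff_polyFun _]
  refine Finset.sum_eq_zero fun s hs => ?_
  have hlt := (sum_le_totalDegree hs).trans_lt h
  rw [mderiv_monomial β s _ hlt.le, if_neg fun heq => by rw [heq] at hlt; exact lt_irrefl _ hlt]
  rfl

/-- The derivatives of order `k` of a polynomial of degree `k` can be prescribed. -/
lemma exists_poly_mderiv_eq (k : ℕ) (c : (Fin d → ℕ) → ℝ) :
    ∃ q : MvPolynomial (Fin d) ℝ, q.totalDegree ≤ k ∧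
      ∀ β : Fin d → ℕ, ∑ i, β i = k → mderiv β (polyFun q) = fun _ => c β := by
  let m : (Fin d → ℕ) → MvPolynomial (Fin d) ℝ := fun α =>
    MvPolynomial.monomial (Finsupp.equivFunOnFinite.symm α) (c α / ∏ i, ((α i).factorial : ℝ))
  refine ⟨∑ α ∈ Finset.piAntidiag Finset.univ k, m α, ?_, fun β hβ => ?_⟩
  · refine (MvPolynomial.totalDegree_finsetSum _ _).trans (Finset.sup_le fun α hα => ?_)
    refine (totalDegree_monomial_le _ _).trans_eq ?_
    simpa using (Finset.mem_piAntidiag.1 hα).1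
  · rw [polyFun_sum, mderiv_sum _ fun _ => contDiff_polyFun _]
    have hβ' : β ∈ Finset.piAntidiag (Finset.univ : Finset (Fin d)) k := by
      simp [Finset.mem_piAntidiag, hβ]
    rw [Finset.sum_eq_single_of_mem β hβ']
    · rw [mderiv_monomial _ _ _ (by simp)]
      funext x
      rw [if_pos (by simp), div_mul_cancel₀]
      exact Finset.prod_ne_zero_iff.2 fun i _ => by positivity
    · intro α hα hne
      have hs := (Finset.mem_piAntidiag.1 hα).1
      rw [mderiv_monomial _ _ _ (by simp [hs, hβ]), if_neg (by simpa using hne)]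
      rfl

/-- Up to lower order terms, scaling acts on polynomials of degree `k` as multiplication by
`h ^ k`. -/
lemma exists_poly_comp_affine_monomial (a : Fin d → ℝ) (h : ℝ) (s : Fin d → ℕ) :
    ∃ q : MvPolynomial (Fin d) ℝ, (q = 0 ∨ q.totalDegree < ∑ i, s i) ∧
      ∀ x : Fin d → ℝ, ∏ i, (a i + h * x i) ^ s i =
        h ^ (∑ i, s i) * ∏ i, x i ^ s i + polyFun q x := by
  induction s using multiIndex_induction with
  | h0 => exact ⟨0, Or.inl rfl, fun x => by simp [polyFun]⟩
  | hs s j ih =>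
    obtain ⟨q, hq, hqx⟩ := ih
    have hprod : ∀ y : Fin d → ℝ, ∏ i, y i ^ (s + Pi.single j 1 : Fin d → ℕ) i =
        (∏ i, y i ^ s i) * y j := by
      intro y
      have : ∀ i, y i ^ (s + Pi.single j 1 : Fin d → ℕ) i = y i ^ s i * if i = j then y j else 1 := by
        intro i
        by_cases hij : i = j
        · subst hij; simp [pow_succ]
        · simp [hij]
      rw [Finset.prod_congr rfl fun i _ => this i, Finset.prod_mul_distrib,
        Finset.prod_ite_eq' Finset.univ j, if_pos (Finset.mem_univ j)]
    refine ⟨MvPolynomial.monomial (Finsupp.equivFunOnFinite.symm s) (a j * h ^ (∑ i, s i)) +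
      (MvPolynomial.C (a j) + MvPolynomial.C h * MvPolynomial.X j) * q, Or.inr ?_, fun x => ?_⟩
    · rw [sum_add_single, Nat.lt_succ_iff]
      refine (MvPolynomial.totalDegree_add _ _).trans (max_le ?_ ?_)
      · refine (totalDegree_monomial_le _ _).trans_eq ?_
        simp
      · rcases hq with rfl | hq
        · simp
        · have hlin : (MvPolynomial.C (a j) + MvPolynomial.C h * MvPolynomial.X j :
              MvPolynomial (Fin d) ℝ).totalDegree ≤ 1 := by
            refine (MvPolynomial.totalDegree_add _ _).trans (max_le (by simp) ?_)
            refine (MvPolynomial.totalDegree_mul _ _).trans ?_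
            simp
          exact (MvPolynomial.totalDegree_mul _ _).trans (by omega)
    · rw [hprod (fun i => a i + h * x i), hprod x, hqx, sum_add_single]
      simp only [polyFun, map_add, map_mul, MvPolynomial.eval_C, MvPolynomial.eval_X,
        MvPolynomial.eval_monomial]
      rw [Finsupp.prod_fintype _ _ (fun _ => pow_zero _)]
      simp only [Finsupp.equivFunOnFinite_symm_apply_apply]
      ring

/-- For `p` of degree at most `k + 1`, the polynomials `p (a + h x)` and `h ^ (k + 1) p (x)`
differ by one of degree at most `k`. -/
lemma exists_poly_comp_affine (a : Fin d → ℝ) (h : ℝ) {k : ℕ} {p : MvPolynomial (Fin d) ℝ}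
    (hp : p.totalDegree ≤ k + 1) :
    ∃ q : MvPolynomial (Fin d) ℝ, q.totalDegree ≤ k ∧
      ∀ x : Fin d → ℝ, polyFun p (a + h • x) = h ^ (k + 1) * polyFun p x + polyFun q x := by
  have hmon : ∀ s ∈ p.support, ∃ q : MvPolynomial (Fin d) ℝ, q.totalDegree ≤ k ∧
      ∀ x : Fin d → ℝ, ∏ i, (a i + h * x i) ^ s i =
        h ^ (k + 1) * ∏ i, x i ^ s i + polyFun q x := by
    intro s hs
    have hsk := (sum_le_totalDegree hs).trans hp
    obtain ⟨q, hq, hqx⟩ := exists_poly_comp_affine_monomial a h s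
    rcases hsk.eq_or_lt with heq | hlt
    · refine ⟨q, ?_, heq ▸ hqx⟩
      rcases hq with rfl | hq
      · simp
      · omega
    · refine ⟨MvPolynomial.monomial s (h ^ (∑ i, s i) - h ^ (k + 1)) + q, ?_, fun x => ?_⟩
      · refine (MvPolynomial.totalDegree_add _ _).trans (max_le ?_ ?_)
        · exact (totalDegree_monomial_le _ _).trans (by omega)
        · rcases hq with rfl | hq
          · simp
          · omega
      · rw [hqx]
        simp only [polyFun, map_add, MvPolynomial.eval_monomial]
        rw [Finsupp.prod_fintype _ _ (fun _ => pow_zero _)]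
        ring
  choose! Q hQ hQx using hmon
  refine ⟨∑ s ∈ p.support, MvPolynomial.C (p.coeff s) * Q s, ?_, fun x => ?_⟩
  · refine (MvPolynomial.totalDegree_finsetSum _ _).trans (Finset.sup_le fun s hs => ?_)
    refine (MvPolynomial.totalDegree_mul _ _).trans ?_
    rw [MvPolynomial.totalDegree_C, zero_add]
    exact hQ s hs
  · have e : ∀ y : Fin d → ℝ, polyFun p y = ∑ s ∈ p.support, p.coeff s * ∏ i, y i ^ s i :=
      fun y => MvPolynomial.eval_eq' y p
    rw [e, e, Finset.mul_sum, polyFun_sum, Finset.sum_apply, ← Finset.sum_add_distrib]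
    refine Finset.sum_congr rfl fun s hs => ?_
    have := hQx s hs x
    simp only [Pi.add_apply, Pi.smul_apply, smul_eq_mul]
    rw [this]
    simp only [polyFun, map_mul, MvPolynomial.eval_C]
    ring

/-! ### The Bramble–Hilbert lemma -/

lemma seminormH_sq (k : ℕ) (U : Set (Fin d → ℝ)) (u : (Fin d → ℝ) → ℝ) :
    seminormH k U u ^ 2 =
      ∑ α ∈ Finset.piAntidiag (Finset.univ : Finset (Fin d)) k, l2norm U (weakDeriv U α u) ^ 2 :=
  Real.sq_sqrt (Finset.sum_nonneg fun _ _ => sq_nonneg _)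

lemma l2norm_weakDeriv_le_seminormH {k : ℕ} (U : Set (Fin d → ℝ)) (u : (Fin d → ℝ) → ℝ)
    {α : Fin d → ℕ} (hα : ∑ i, α i = k) : l2norm U (weakDeriv U α u) ≤ seminormH k U u := by
  refine Real.le_sqrt_of_sq_le ?_
  exact Finset.single_le_sum (f := fun α => l2norm U (weakDeriv U α u) ^ 2)
    (fun _ _ => sq_nonneg _) (by simp [Finset.mem_piAntidiag, hα])

/-- A function in `H^{r+1}` is approximated by polynomials of degree at most `r`, in the
seminorm of `H¹`, up to a multiple of any bound for its derivatives of order `r + 1`. -/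
theorem exists_brambleHilbert (d r : ℕ) : ∃ C : ℝ, 0 ≤ C ∧ ∀ (u : (Fin d → ℝ) → ℝ) (b : ℝ),
    MemH (r + 1) (unitCube d) u →
    (∀ α : Fin d → ℕ, ∑ i, α i = r + 1 →
      l2norm (unitCube d) (weakDeriv (unitCube d) α u) ≤ b) →
    ∃ p : MvPolynomial (Fin d) ℝ, p.totalDegree ≤ r ∧
      ∀ i, l2norm (unitCube d) (weakDeriv (unitCube d) (Pi.single i 1) (u - polyFun p)) ≤
        C * b := by
  induction r with
  | zero =>
    refine ⟨1, zero_le_one, fun u b _ hb => ⟨0, by simp, fun i => ?_⟩⟩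
    rw [polyFun_zero, sub_zero, one_mul]
    exact hb _ (by simp)
  | succ r ih =>
    obtain ⟨C, hC, h⟩ := ih
    obtain ⟨P, hP, hpoin⟩ := exists_poincare d
    refine ⟨C * (P * d), by positivity, fun u b hu hb => ?_⟩
    have hmean : ∀ β : Fin d → ℕ, ∑ i, β i = r + 1 → ∃ c : ℝ,
        l2norm (unitCube d) (fun x => weakDeriv (unitCube d) β u x - c) ≤ P * d * b := by
      intro β hβ
      have hdeg : ∀ i, ∑ k, (β + Pi.single i 1 : Fin d → ℕ) k = r + 1 + 1 := fun i => by
        rw [sum_add_single, hβ]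
      obtain ⟨c, hc⟩ := hpoin (weakDeriv (unitCube d) β u)
        (fun i => weakDeriv (unitCube d) (β + Pi.single i 1) u)
        (hu.memLp_weakDeriv isOpen_unitCube (by omega))
        (fun i => (hu.hasWeakDeriv (by omega)).of_add_single (hu.hasWeakDeriv (hdeg i).le))
        (fun i => hu.memLp_weakDeriv isOpen_unitCube (hdeg i).le)
      refine ⟨c, hc.trans ?_⟩
      rw [mul_assoc]
      refine mul_le_mul_of_nonneg_left ?_ hP
      refine (Finset.sum_le_sum fun i _ => hb _ (hdeg i)).trans_eq ?_
      simp
    choose! c hc using hmean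
    -- a homogeneous polynomial removes the means of the derivatives of order `r + 1`
    obtain ⟨q, hq, hqd⟩ := exists_poly_mderiv_eq (r + 1) c
    have hqH := memH_of_contDiff (contDiff_polyFun q) (r + 1) 0 1
    obtain ⟨p, hp, hpe⟩ := h (u - polyFun q) (P * d * b)
      ((hu.mono (by omega) subset_rfl).sub hqH) (by
        intro β hβ
        have h1 := (hu.hasWeakDeriv (α := β) (by omega)).sub
          (hasWeakDeriv_mderiv (U := unitCube d) (contDiff_polyFun q) β)
        rw [l2norm_congr (h1.weakDeriv_ae_eq isOpen_unitCube), hqd β hβ]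
        exact hc β hβ)
    refine ⟨q + p, (MvPolynomial.totalDegree_add _ _).trans (max_le hq (by omega)), fun i => ?_⟩
    rw [polyFun_add, ← sub_sub, mul_assoc]
    exact hpe i

/-! ### Geometry of the mesh -/

lemma element_pairwiseDisjoint {n : ℕ} (hn : 1 ≤ n) :
    Pairwise fun k l : Fin d → Fin n => Disjoint (element n k) (element n l) := by
  intro k l hkl
  rw [Set.disjoint_left]
  intro x hk hl
  apply hkl
  funext i
  have hn0 : (0 : ℝ) < n := by exact_mod_cast hn
  have aux : ∀ a b : Fin n, x i ∈ Set.Ioo (((a : ℕ) : ℝ) / n) (((a : ℕ) : ℝ) / n + 1 / n) →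
      x i ∈ Set.Ioo (((b : ℕ) : ℝ) / n) (((b : ℕ) : ℝ) / n + 1 / n) → (a : ℕ) ≤ b := by
    intro a b ha hb
    have h1 : ((a : ℕ) : ℝ) / n < ((b : ℕ) : ℝ) / n + 1 / n := ha.1.trans hb.2
    rw [← add_div, div_lt_div_iff_of_pos_right hn0] at h1
    exact Nat.lt_succ_iff.1 (by exact_mod_cast h1)
  have hk' := hk i trivial
  have hl' := hl i trivial
  exact Fin.ext (le_antisymm (aux _ _ hk' hl') (aux _ _ hl' hk'))

lemma element_subset {n : ℕ} (hn : 1 ≤ n) (k : Fin d → Fin n) : element n k ⊆ unitCube d := by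
  intro x hx
  have hn0 : (0 : ℝ) < n := by exact_mod_cast hn
  refine mem_unitCube.2 fun i => ?_
  have h := hx i trivial
  refine ⟨lt_of_le_of_lt (by unfold corner; positivity) h.1, h.2.trans_le ?_⟩
  simp only [corner]
  rw [← add_div, div_le_one hn0]
  exact_mod_cast (k i).2

lemma isOpen_element (n : ℕ) (k : Fin d → Fin n) : IsOpen (element n k) := isOpen_cube _ _

/-- The elements are disjoint subsets of the unit cube, and weak derivatives restrict. -/
lemma sum_seminormH_element_sq_le {n : ℕ} (hn : 1 ≤ n) {m : ℕ} {u : (Fin d → ℝ) → ℝ}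
    (hu : MemH m (unitCube d) u) :
    ∑ k : Fin d → Fin n, seminormH m (element n k) u ^ 2 ≤ seminormH m (unitCube d) u ^ 2 := by
  simp only [seminormH_sq]
  rw [Finset.sum_comm]
  refine Finset.sum_le_sum fun α hα => ?_
  have hα' : ∑ i, α i ≤ m := (Finset.mem_piAntidiag.1 hα).1.le
  have hmem := hu.memLp_weakDeriv isOpen_unitCube hα'
  set g := weakDeriv (unitCube d) α u
  have hmemk : ∀ k : Fin d → Fin n, MemLp g 2 (volume.restrict (element n k)) := fun k =>
    hmem.mono_measure (Measure.restrict_mono (element_subset hn k) le_rfl)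
  have h1 : ∀ k : Fin d → Fin n, l2norm (element n k) (weakDeriv (element n k) α u) ^ 2 =
      ∫ x in element n k, g x ^ 2 := by
    intro k
    have hw := ((hu.hasWeakDeriv hα').mono (element_subset hn k)).weakDeriv_ae_eq
      (isOpen_element n k)
    rw [l2norm_congr hw, l2norm_sq (hmemk k)]
  rw [Finset.sum_congr rfl fun k _ => h1 k, l2norm_sq hmem,
    ← integral_biUnion_finset _ (fun k _ => (isOpen_element n k).measurableSet)
      (fun k _ l _ hkl => element_pairwiseDisjoint hn hkl) (fun k _ => (hmemk k).integrable_sq)]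
  refine setIntegral_mono_set hmem.integrable_sq (ae_of_all _ fun x => sq_nonneg _) ?_
  exact (Set.iUnion₂_subset fun k _ => element_subset hn k).eventuallyLE

/-! ### The best approximation -/

lemma brokenGradNorm_nonneg (n : ℕ) (w : (Fin d → ℝ) → ℝ) : 0 ≤ brokenGradNorm n w :=
  Real.sqrt_nonneg _

lemma brokenGradNorm_sq (n : ℕ) (w : (Fin d → ℝ) → ℝ) :
    brokenGradNorm n w ^ 2 = ∑ k : Fin d → Fin n, ∑ i : Fin d,
      l2norm (element n k) (weakDeriv (element n k) (Pi.single i 1) w) ^ 2 :=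
  Real.sq_sqrt (Finset.sum_nonneg fun _ _ => Finset.sum_nonneg fun _ _ => sq_nonneg _)

lemma gradBestApprox_nonneg (S : Submodule ℝ (L2Ref d)) (n : ℕ) (u : (Fin d → ℝ) → ℝ) :
    0 ≤ gradBestApprox S n u :=
  Real.sInf_nonneg fun _ ⟨_, _, _, he⟩ => he ▸ brokenGradNorm_nonneg _ _

lemma gradBestApprox_le {S : Submodule ℝ (L2Ref d)} {n : ℕ} {u v : (Fin d → ℝ) → ℝ}
    (hv : v ∈ meshSpace S n) (hv' : ∀ k : Fin d → Fin n, MemH 1 (element n k) v) :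
    gradBestApprox S n u ≤ brokenGradNorm n (u - v) :=
  csInf_le ⟨0, fun _ ⟨_, _, _, he⟩ => he ▸ brokenGradNorm_nonneg _ _⟩ ⟨v, hv, hv', rfl⟩

/-- Lower bounds for the infimum; the set is not empty because it contains the error of `v = 0`,
so the convention for `sInf ∅` plays no role. -/
lemma le_gradBestApprox {S : Submodule ℝ (L2Ref d)} {n : ℕ} {u : (Fin d → ℝ) → ℝ} {b : ℝ}
    (h : ∀ v ∈ meshSpace S n, (∀ k : Fin d → Fin n, MemH 1 (element n k) v) →
      b ≤ brokenGradNorm n (u - v)) : b ≤ gradBestApprox S n u := by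
  refine le_csInf ⟨_, 0, fun k => ⟨0, S.zero_mem, ?_⟩, fun k => ?_, rfl⟩ ?_
  · exact (Lp.coeFn_zero ℝ 2 (volume.restrict (unitCube d))).symm
  · exact memH_of_contDiff contDiff_const 1 _ _
  · rintro e ⟨v, hv, hv', rfl⟩
    exact h v hv hv'

/-! ### Membership in `P₀ + S` -/

lemma mem_polySpace_zero {f : L2Ref d} :
    f ∈ polySpace d 0 ↔ ∃ c : ℝ, f =ᵐ[volume.restrict (unitCube d)] fun _ => c := by
  constructor
  · rintro ⟨p, hp, hfp⟩
    rw [MvPolynomial.totalDegree_eq_zero_iff_eq_C.1 (Nat.le_zero.1 hp)] at hfp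
    exact ⟨_, by simpa using hfp⟩
  · rintro ⟨c, hc⟩
    exact ⟨MvPolynomial.C c, by simp, by simpa using hc⟩

lemma mem_polySpace_zero_sup {S : Submodule ℝ (L2Ref d)} {f : L2Ref d} :
    f ∈ polySpace d 0 ⊔ S ↔
      ∃ s ∈ S, ∃ c : ℝ, f =ᵐ[volume.restrict (unitCube d)] fun x => s x + c := by
  rw [Submodule.mem_sup]
  constructor
  · rintro ⟨y, hy, s, hs, rfl⟩
    obtain ⟨c, hc⟩ := mem_polySpace_zero.1 hy
    refine ⟨s, hs, c, ?_⟩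
    filter_upwards [hc, Lp.coeFn_add y s] with x h1 h2
    rw [h2, Pi.add_apply, h1, add_comm]
  · rintro ⟨s, hs, c, h⟩
    refine ⟨f - s, mem_polySpace_zero.2 ⟨c, ?_⟩, s, hs, sub_add_cancel f s⟩
    filter_upwards [h, Lp.coeFn_sub f s] with x h1 h2
    rw [h2, Pi.sub_apply, h1, add_sub_cancel_left]

/-- A polynomial as a member of `L²` of the reference element. -/
noncomputable def polyLp (p : MvPolynomial (Fin d) ℝ) : L2Ref d :=
  (memLp_of_continuous (contDiff_polyFun p).continuous 0 1).toLp (polyFun p)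

lemma coeFn_polyLp (p : MvPolynomial (Fin d) ℝ) :
    polyLp p =ᵐ[volume.restrict (unitCube d)] polyFun p := MemLp.coeFn_toLp _

lemma polySpace_le_iff {r : ℕ} {W : Submodule ℝ (L2Ref d)} :
    polySpace d r ≤ W ↔ ∀ p : MvPolynomial (Fin d) ℝ, p.totalDegree ≤ r → polyLp p ∈ W := by
  constructor
  · exact fun h p hp => h ⟨p, hp, coeFn_polyLp p⟩
  · rintro h f ⟨p, hp, hfp⟩
    have : f = polyLp p := Lp.ext (hfp.trans (coeFn_polyLp p).symm)
    exact this ▸ h p hp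

instance finiteDimensional_polySpace_zero : FiniteDimensional ℝ (polySpace d 0) := by
  have hle : polySpace d 0 ≤ Submodule.span ℝ {polyLp (d := d) 1} := by
    intro f hf
    obtain ⟨c, hc⟩ := mem_polySpace_zero.1 hf
    refine Submodule.mem_span_singleton.2 ⟨c, Lp.ext ?_⟩
    filter_upwards [hc, Lp.coeFn_smul c (polyLp (d := d) 1), coeFn_polyLp (d := d) 1]
      with x h1 h2 h3
    rw [h2, h1, Pi.smul_apply, h3]
    simp [polyFun]
  exact Submodule.finiteDimensional_of_le hle

/-! ### The upper bound -/

/-- The gradient does not see an additive constant. -/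
lemma l2norm_weakDeriv_add_const {U : Set (Fin d → ℝ)} (hU : IsOpen U) {u v : (Fin d → ℝ) → ℝ}
    (hu : MemH 1 U u) {c : ℝ} (h : v =ᵐ[volume.restrict U] fun x => u x + c) (i : Fin d) :
    l2norm U (weakDeriv U (Pi.single i 1) v) = l2norm U (weakDeriv U (Pi.single i 1) u) := by
  have h1 := hu.hasWeakDeriv (α := Pi.single i 1) (by simp)
  have h2 := h1.add (hasWeakDeriv_pderiv (U := U) (p := fun _ => c) contDiff_const i)
  rw [show pderiv i (fun _ => c) = 0 by funext x; simp [pderiv], add_zero] at h2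
  exact l2norm_congr ((h2.congr h.symm EventuallyEq.rfl).weakDeriv_ae_eq hU)

/-- If `P_r ⊆ P₀ + S`, then the best approximation is of order `h ^ r`. -/
lemma exists_gradBestApprox_le {S : Submodule ℝ (L2Ref d)} {r : ℕ}
    (hS : polySpace d r ≤ polySpace d 0 ⊔ S) :
    ∃ C : ℝ, ∀ n : ℕ, 1 ≤ n → ∀ u : (Fin d → ℝ) → ℝ, MemH (r + 1) (unitCube d) u →
      gradBestApprox S n u ≤ C * (1 / (n : ℝ)) ^ r * seminormH (r + 1) (unitCube d) u := by
  obtain ⟨C, hC, hBH⟩ := exists_brambleHilbert d r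
  refine ⟨√d * C, fun n hn u hu => ?_⟩
  have hh : (0 : ℝ) < 1 / (n : ℝ) := by
    have : (0 : ℝ) < n := by exact_mod_cast hn
    positivity
  set h : ℝ := 1 / (n : ℝ) with hhdef
  have huk : ∀ k : Fin d → Fin n, MemH (r + 1) (cube (corner n k) h) u := fun k =>
    hu.mono le_rfl (element_subset hn k)
  have hb : ∀ (k : Fin d → Fin n) (α : Fin d → ℕ), ∑ i, α i = r + 1 →
      l2norm (unitCube d) (weakDeriv (unitCube d) α fun x => u (corner n k + h • x)) ≤
        seminormH (r + 1) (unitCube d) fun x => u (corner n k + h • x) :=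
    fun k α hα => l2norm_weakDeriv_le_seminormH _ _ hα
  have hseq : ∀ k : Fin d → Fin n,
      seminormH (r + 1) (unitCube d) (fun x => u (corner n k + h • x)) ^ 2 =
        h ^ (2 * (r + 1)) * (h ^ d)⁻¹ * seminormH (r + 1) (element n k) u ^ 2 := by
    intro k
    rw [seminormH_sq, seminormH_sq, Finset.mul_sum]
    refine Finset.sum_congr rfl fun α hα => ?_
    have hα' := (Finset.mem_piAntidiag.1 hα).1
    rw [l2norm_weakDeriv_comp_affine_sq hh (huk k) hα'.le, hα']
    rfl
  choose p hp hpe using fun k : Fin d → Fin n => hBH _ _ ((huk k).comp_affine hh) (hb k)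
  choose s hs c hc using fun k : Fin d → Fin n =>
    mem_polySpace_zero_sup.1 (polySpace_le_iff.1 hS (p k) (hp k))
  -- on each element, the approximation is the polynomial corrected by a constant
  let w : (Fin d → Fin n) → (Fin d → ℝ) → ℝ := fun k x =>
    polyFun (p k) (-(h⁻¹ • corner n k) + h⁻¹ • x) - c k
  have hw : ∀ k, ContDiff ℝ ∞ (w k) := fun k =>
    (contDiff_comp_affine (contDiff_polyFun _) _ _).sub contDiff_const
  let v : (Fin d → ℝ) → ℝ := fun x => ∑ k, (element n k).indicator (w k) x
  have hv : ∀ k, ∀ x ∈ element n k, v x = w k x := by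
    intro k x hx
    simp only [v]
    rw [Finset.sum_eq_single k, Set.indicator_of_mem hx]
    · intro l _ hl
      exact Set.indicator_of_notMem
        (fun hxl => Set.disjoint_left.1 (element_pairwiseDisjoint hn hl) hxl hx) _
    · intro hk
      exact absurd (Finset.mem_univ k) hk
  have hvhat : ∀ k, ∀ x ∈ unitCube d, v (corner n k + h • x) = polyFun (p k) x - c k := by
    intro k x hx
    rw [← preimage_cube (corner n k) hh] at hx
    rw [hv k _ hx]
    simp only [w]
    rw [smul_add, smul_smul, inv_mul_cancel₀ hh.ne', one_smul, neg_add_cancel_left]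
  have hvS : v ∈ meshSpace S n := by
    refine fun k => ⟨s k, hs k, ?_⟩
    filter_upwards [ae_restrict_mem isOpen_unitCube.measurableSet, hc k, coeFn_polyLp (p k)]
      with x hx h1 h2
    rw [hvhat k x hx, ← h2, h1, add_sub_cancel_right]
  have hvH : ∀ k, MemH 1 (element n k) v := by
    intro k
    refine (memH_of_contDiff (hw k) 1 _ _).congr ?_
    filter_upwards [ae_restrict_mem (isOpen_element n k).measurableSet] with x hx
    exact (hv k x hx).symm
  have hloc : ∀ k i, l2norm (element n k) (weakDeriv (element n k) (Pi.single i 1) (u - v)) ^ 2 ≤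
      C ^ 2 * h ^ (2 * r) * seminormH (r + 1) (element n k) u ^ 2 := by
    intro k i
    have e1 := l2norm_weakDeriv_comp_affine_sq (α := Pi.single i 1) hh
      (((huk k).mono (l := 1) (by omega) subset_rfl).sub (hvH k)) (by simp)
    have huQ : MemH 1 (unitCube d) ((fun x => u (corner n k + h • x)) - polyFun (p k)) :=
      (((huk k).comp_affine hh).mono (by omega) subset_rfl).sub
        (memH_of_contDiff (contDiff_polyFun _) 1 _ _)
    rw [l2norm_weakDeriv_add_const isOpen_unitCube huQ (c := c k) (by
      filter_upwards [ae_restrict_mem isOpen_unitCube.measurableSet] with x hx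
      simp only [Pi.sub_apply]
      rw [hvhat k x hx]
      ring), Finset.sum_pi_single', if_pos (Finset.mem_univ i), mul_one] at e1
    have e2 := pow_le_pow_left₀ (l2norm_nonneg _ _) (hpe k i) 2
    rw [mul_pow, hseq, e1] at e2
    have hpos : 0 < h ^ 2 * (h ^ d)⁻¹ := by positivity
    refine le_of_mul_le_mul_left (e2.trans_eq ?_) hpos
    ring
  refine (gradBestApprox_le hvS hvH).trans ?_
  refine Real.sqrt_le_iff.2 ⟨?_, ?_⟩
  · have : 0 ≤ seminormH (r + 1) (unitCube d) u := Real.sqrt_nonneg _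
    exact mul_nonneg (by positivity) this
  · calc _ ≤ ∑ k : Fin d → Fin n, ∑ _i : Fin d,
          C ^ 2 * h ^ (2 * r) * seminormH (r + 1) (element n k) u ^ 2 :=
        Finset.sum_le_sum fun k _ => Finset.sum_le_sum fun i _ => hloc k i
      _ = d * (C ^ 2 * h ^ (2 * r)) * ∑ k : Fin d → Fin n,
          seminormH (r + 1) (element n k) u ^ 2 := by
        simp only [Finset.sum_const, Finset.card_univ, Fintype.card_fin, nsmul_eq_mul,
          Finset.mul_sum]
        exact Finset.sum_congr rfl fun k _ => by ring
      _ ≤ d * (C ^ 2 * h ^ (2 * r)) * seminormH (r + 1) (unitCube d) u ^ 2 :=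
        mul_le_mul_of_nonneg_left (sum_seminormH_element_sq_le hn hu) (by positivity)
      _ = _ := by
        rw [mul_pow, mul_pow, mul_pow, Real.sq_sqrt (Nat.cast_nonneg d)]
        ring

/-! ### The lower bound -/

/-- If the polynomials of degree at most `k` are in `P₀ + S` and `p` of degree at most `k + 1`
has distance at least `δ` from this space, then the error for `p` is at least a multiple of
`h ^ k δ`. -/
lemma exists_le_brokenGradNorm (d : ℕ) : ∃ C : ℝ, 0 ≤ C ∧ ∀ (S : Submodule ℝ (L2Ref d)) (k : ℕ)
    (p : MvPolynomial (Fin d) ℝ) (δ : ℝ), p.totalDegree ≤ k + 1 → 0 ≤ δ →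
    polySpace d k ≤ polySpace d 0 ⊔ S →
    (∀ f ∈ polySpace d 0 ⊔ S, δ ≤ ‖polyLp p - f‖) → ∀ n : ℕ, 1 ≤ n → ∀ v ∈ meshSpace S n,
    (∀ l : Fin d → Fin n, MemH 1 (element n l) v) →
    (1 / (n : ℝ)) ^ k * δ ≤ C * brokenGradNorm n (polyFun p - v) := by
  obtain ⟨C, hC, hpoin⟩ := exists_poincare d
  refine ⟨C * √d, by positivity, fun S k p δ hp hδ hk hdist n hn v hv hvH => ?_⟩
  have hn0 : (0 : ℝ) < n := by exact_mod_cast hn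
  have hh : (0 : ℝ) < 1 / (n : ℝ) := by positivity
  set h : ℝ := 1 / (n : ℝ) with hhdef
  have hloc : ∀ l : Fin d → Fin n, h ^ d * (h ^ k * δ) ^ 2 ≤ C ^ 2 * d * ∑ i : Fin d,
      l2norm (element n l) (weakDeriv (element n l) (Pi.single i 1) (polyFun p - v)) ^ 2 := by
    intro l
    have hwH : MemH 1 (cube (corner n l) h) (polyFun p - v) :=
      (memH_of_contDiff (contDiff_polyFun p) 1 _ _).sub (hvH l)
    have hwQ := hwH.comp_affine hh
    obtain ⟨c, hc⟩ := hpoin _ (fun i => weakDeriv (unitCube d) (Pi.single i 1) _) hwQ.1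
      (fun i => hwQ.hasWeakDeriv (by simp)) (fun i => hwQ.memLp_weakDeriv isOpen_unitCube (by simp))
    obtain ⟨q, hq, hqx⟩ := exists_poly_comp_affine (corner n l) h hp
    obtain ⟨s, hs, hvs⟩ := hv l
    have hf₀ : s - polyLp q + polyLp (MvPolynomial.C c) ∈ polySpace d 0 ⊔ S :=
      add_mem (sub_mem (Submodule.mem_sup_right hs) (polySpace_le_iff.1 hk q hq))
        (Submodule.mem_sup_left (polySpace_le_iff.1 le_rfl _ (by simp)))
    -- the pull-back of `p - v`, minus `c`, is `h ^ (k + 1) p - f₀` with `f₀` in `P₀ + S`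
    set f₀ : L2Ref d := s - polyLp q + polyLp (MvPolynomial.C c) with hf₀def
    have hE : (fun x => (polyFun p - v) (corner n l + h • x) - c)
        =ᵐ[volume.restrict (unitCube d)] (h ^ (k + 1) • polyLp p - f₀ : L2Ref d) := by
      filter_upwards [hvs, Lp.coeFn_sub (h ^ (k + 1) • polyLp p) f₀,
        Lp.coeFn_smul (h ^ (k + 1)) (polyLp p), coeFn_polyLp p,
        Lp.coeFn_add (s - polyLp q) (polyLp (MvPolynomial.C c)), Lp.coeFn_sub s (polyLp q),
        coeFn_polyLp q, coeFn_polyLp (MvPolynomial.C c)] with x h1 h2 h3 h4 h5 h6 h7 h8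
      simp only [Pi.sub_apply, Pi.add_apply, Pi.smul_apply, smul_eq_mul] at h2 h3 h5 h6 ⊢
      rw [h2, h3, h4, hf₀def, h5, h6, h7, h8, polyFun_C, hqx, ← h1]
      ring
    have hnorm : l2norm (unitCube d) (fun x => (polyFun p - v) (corner n l + h • x) - c) =
        ‖h ^ (k + 1) • polyLp p - f₀‖ := by
      rw [l2norm_congr hE, Lp.norm_def]
      rfl
    have hlow : h ^ (k + 1) * δ ≤ ‖h ^ (k + 1) • polyLp p - f₀‖ := by
      have e : h ^ (k + 1) • polyLp p - f₀ =
          h ^ (k + 1) • (polyLp p - (h ^ (k + 1))⁻¹ • f₀) := by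
        rw [smul_sub, smul_smul, mul_inv_cancel₀ (by positivity), one_smul]
      rw [e, norm_smul, Real.norm_of_nonneg (by positivity)]
      exact mul_le_mul_of_nonneg_left (hdist _ (Submodule.smul_mem _ _ hf₀)) (by positivity)
    rw [hnorm] at hc
    have e1 := pow_le_pow_left₀ (by positivity) (hlow.trans hc) 2
    have e2 := sq_sum_le_card_mul_sum_sq (s := (Finset.univ : Finset (Fin d)))
      (f := fun i => l2norm (unitCube d) (weakDeriv (unitCube d) (Pi.single i 1)
        (fun x => (polyFun p - v) (corner n l + h • x))))
    have e3 : ∀ i : Fin d, l2norm (unitCube d) (weakDeriv (unitCube d) (Pi.single i 1)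
        (fun x => (polyFun p - v) (corner n l + h • x))) ^ 2 = h ^ 2 * (h ^ d)⁻¹ *
        l2norm (element n l) (weakDeriv (element n l) (Pi.single i 1) (polyFun p - v)) ^ 2 := by
      intro i
      rw [l2norm_weakDeriv_comp_affine_sq hh hwH (by simp), Finset.sum_pi_single',
        if_pos (Finset.mem_univ i), mul_one]
      rfl
    rw [Finset.sum_congr rfl fun i _ => e3 i, ← Finset.mul_sum, Finset.card_univ,
      Fintype.card_fin] at e2
    rw [mul_pow C] at e1
    have e4 := e1.trans (mul_le_mul_of_nonneg_left e2 (sq_nonneg C))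
    have hpos : 0 < h ^ 2 * (h ^ d)⁻¹ := by positivity
    have hinv : h ^ d * (h ^ d)⁻¹ = 1 := mul_inv_cancel₀ (by positivity)
    refine le_of_mul_le_mul_left (Eq.trans_le ?_ (e4.trans_eq ?_)) hpos
    · linear_combination (h ^ (k + 1) * δ) ^ 2 * hinv
    · ring
  have hsum := Finset.sum_le_sum fun l (_ : l ∈ (Finset.univ : Finset (Fin d → Fin n))) => hloc l
  rw [← Finset.mul_sum (a := C ^ 2 * d), ← brokenGradNorm_sq, Finset.sum_const, Finset.card_univ,
    Fintype.card_fun, Fintype.card_fin, Fintype.card_fin, nsmul_eq_mul, ← mul_assoc] at hsum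
  -- the `n ^ d` elements compensate for the volume `h ^ d` of each
  have hcard : (((n ^ d : ℕ) : ℝ)) * h ^ d = 1 := by
    rw [Nat.cast_pow, ← mul_pow, hhdef, mul_one_div_cancel hn0.ne', one_pow]
  rw [hcard, one_mul] at hsum
  refine (pow_le_pow_iff_left₀ (by positivity)
    (mul_nonneg (by positivity) (brokenGradNorm_nonneg _ _)) two_ne_zero).1 (hsum.trans_eq ?_)
  rw [mul_pow, mul_pow, Real.sq_sqrt (Nat.cast_nonneg d)]

/-- Induction on the degree `k`: the lower bound `h ^ k δ` contradicts `o (h ^ (r - 1))` unless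
`δ = 0`. -/
lemma polySpace_le_of_isLittleO {S : Submodule ℝ (L2Ref d)} (hS : FiniteDimensional ℝ S) {r : ℕ}
    (h : ∀ p : MvPolynomial (Fin d) ℝ, p.totalDegree ≤ r →
      (fun n : ℕ => gradBestApprox S n (polyFun p)) =o[atTop]
        (fun n : ℕ => (1 / (n : ℝ)) ^ ((r : ℤ) - 1))) (k : ℕ) (hkr : k ≤ r) :
    polySpace d k ≤ polySpace d 0 ⊔ S := by
  induction k with
  | zero => exact le_sup_left
  | succ k ih =>
    have hk := ih (by omega)
    obtain ⟨C, hC, hlow⟩ := exists_le_brokenGradNorm d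
    rw [polySpace_le_iff]
    intro p hp
    by_contra hnot
    set W := polySpace d 0 ⊔ S with hW
    have hclosed : IsClosed (W : Set (L2Ref d)) := W.closed_of_finiteDimensional
    have hδ : 0 < Metric.infDist (polyLp p) (W : Set (L2Ref d)) :=
      (hclosed.notMem_iff_infDist_pos ⟨0, W.zero_mem⟩).1 hnot
    set δ := Metric.infDist (polyLp p) (W : Set (L2Ref d)) with hδdef
    have hdist : ∀ f ∈ W, δ ≤ ‖polyLp p - f‖ := fun f hf => by
      rw [← dist_eq_norm]
      exact Metric.infDist_le_dist_of_mem hf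
    have hε : 0 < δ / (2 * (C + 1)) := by positivity
    obtain ⟨n, hn1, hn⟩ := (((h p (hp.trans hkr)).def hε).and (eventually_ge_atTop 1)).exists
    have hn0 : (1 : ℝ) ≤ n := by exact_mod_cast hn
    have hh0 : (0 : ℝ) < 1 / (n : ℝ) := by positivity
    have hh1 : 1 / (n : ℝ) ≤ 1 := by rw [div_le_one (by positivity)]; exact hn0
    have hr : (r : ℤ) - 1 = ((r - 1 : ℕ) : ℤ) := by omega
    rw [hr, zpow_natCast, Real.norm_of_nonneg (gradBestApprox_nonneg _ _ _),
      Real.norm_of_nonneg (by positivity)] at hn1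
    have hpow : (1 / (n : ℝ)) ^ (r - 1) ≤ (1 / (n : ℝ)) ^ k :=
      pow_le_pow_of_le_one hh0.le hh1 (by omega)
    have hkey : (1 / (n : ℝ)) ^ k * δ / (C + 1) ≤ gradBestApprox S n (polyFun p) := by
      refine le_gradBestApprox fun v hv hv' => ?_
      rw [div_le_iff₀ (by positivity), mul_comm (brokenGradNorm _ _)]
      refine (hlow S k p δ hp hδ.le hk hdist n hn v hv hv').trans ?_
      exact mul_le_mul_of_nonneg_right (by linarith) (brokenGradNorm_nonneg _ _)
    have hchain := hkey.trans (hn1.trans (mul_le_mul_of_nonneg_left hpow hε.le))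
    have hpos : 0 < (1 / (n : ℝ)) ^ k * δ / (C + 1) := by positivity
    have e : δ / (2 * (C + 1)) * (1 / (n : ℝ)) ^ k = (1 / (n : ℝ)) ^ k * δ / (C + 1) / 2 := by
      field_simp
    rw [e] at hchain
    linarith

lemma seminormH_polyFun {r : ℕ} {p : MvPolynomial (Fin d) ℝ} (hp : p.totalDegree ≤ r) :
    seminormH (r + 1) (unitCube d) (polyFun p) = 0 := by
  rw [← sq_eq_zero_iff, seminormH_sq]
  refine Finset.sum_eq_zero fun α hα => ?_
  have hα' := (Finset.mem_piAntidiag.1 hα).1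
  have h1 := (hasWeakDeriv_mderiv (U := unitCube d) (contDiff_polyFun p) α).weakDeriv_ae_eq
    isOpen_unitCube
  rw [mderiv_polyFun_eq_zero (hp.trans_lt (hα'.symm ▸ Nat.lt_succ_self r))] at h1
  rw [l2norm_congr h1]
  simp [l2norm]

end CubeFE

theorem mainTheorem4 (d : ℕ) (hd : 1 ≤ d) (S : Submodule ℝ (CubeFE.L2Ref d))
    (hS : FiniteDimensional ℝ S) (r : ℕ) :
    List.TFAE [
      ∃ C : ℝ, ∀ n : ℕ, 1 ≤ n → ∀ u : (Fin d → ℝ) → ℝ,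
        CubeFE.MemH (r + 1) (CubeFE.unitCube d) u →
          CubeFE.gradBestApprox S n u ≤
            C * (1 / (n : ℝ)) ^ r * CubeFE.seminormH (r + 1) (CubeFE.unitCube d) u,
      ∀ p : MvPolynomial (Fin d) ℝ, p.totalDegree ≤ r →
        (fun n : ℕ => CubeFE.gradBestApprox S n (fun x => MvPolynomial.eval x p)) =o[atTop]
          (fun n : ℕ => (1 / (n : ℝ)) ^ ((r : ℤ) - 1)),
      CubeFE.polySpace d r ≤ CubeFE.polySpace d 0 ⊔ S] := by
  tfae_have 1 → 2 := by
    rintro ⟨C, hC⟩ p hp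
    have hzero : ∀ n : ℕ, 1 ≤ n → CubeFE.gradBestApprox S n (CubeFE.polyFun p) = 0 := by
      intro n hn
      have h := hC n hn _ (CubeFE.memH_of_contDiff (CubeFE.contDiff_polyFun p) (r + 1) 0 1)
      rw [CubeFE.seminormH_polyFun hp, mul_zero] at h
      exact le_antisymm h (CubeFE.gradBestApprox_nonneg _ _ _)
    refine IsLittleO.congr' (isLittleO_zero _ atTop) ?_ EventuallyEq.rfl
    filter_upwards [eventually_ge_atTop 1] with n hn
    exact (hzero n hn).symm
  tfae_have 2 → 3 := fun h => CubeFE.polySpace_le_of_isLittleO hS h r le_rfl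
  tfae_have 3 → 1 := CubeFE.exists_gradBestApprox_le
  tfae_finish
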